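/- **Syntax.** Formulas are the terms over the language $\{\wedge,\vee,\cdot,\backslash,/,{}^*,0,1\}$ of action lattices in countably many propositional variables. A sequent $\Gamma\Rightarrow\beta$ consists of a finite sequence $\Gamma$ of formulas and a formula $\beta$; $\alpha^{(n)}$ is the sequence of $n$ copies of $\alpha$. A schematic rule is a list of premises and a conclusion, which are sequents built from metaformulas (terms in formula metavariables) and, on the left, also sequence metavariables; its instances arise by replacing formula metavariables by formulas and sequence metavariables by finite sequences of formulas. A schematic rule is *analytic* if it has the shape $$\frac{\Gamma,\Upsilon_0,\Delta\Rightarrow\beta\quad\cdots\quad\Gamma,\Upsilon_{n-1},\Delta\Rightarrow\beta}{\Gamma,\Upsilon,\Delta\Rightarrow\beta}\qquad(n\ge 0)$$ where $\Gamma,\Delta$ are sequence metavariables, $\beta$ is a formula metavariable, $\Upsilon$ is a finite sequence of sequence metavariables, the entries of $\Gamma,\Upsilon,\Delta$ are pairwise distinct, and each $\Upsilon_i$ is a finite sequence (repetitions allowed) of metavariables occurring in $\Upsilon$. **Rules.** The common rules are: $a\Rightarrow a$ for propositional variables $a$; and the schematic rules (premises $/$ conclusion; boxes mark principal formulas in conclusions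 and auxiliary formulas in premises) - $/\ \Gamma,\boxed{0},\Delta\Rightarrow\beta$; $\quad\Gamma,\Delta\Rightarrow\beta\ /\ \Gamma,\boxed{1},\Delta\Rightarrow\beta$; $\quad/\ \Rightarrow\boxed{1}$; - $\Gamma,\boxed{\alpha_i},\Delta\Rightarrow\beta\ /\ \Gamma,\boxed{\alpha_0\wedge\alpha_1},\Delta\Rightarrow\beta$ for $i=0,1$; $\quad\Gamma\Rightarrow\boxed{\beta_0};\ \Gamma\Rightarrow\boxed{\beta_1}\ /\ \Gamma\Rightarrow\boxed{\beta_0\wedge\beta_1}$; - $\Gamma,\boxed{\alpha_0},\Delta\Rightarrow\beta;\ \Gamma,\boxed{\alpha_1},\Delta\Rightarrow\beta\ /\ \Gamma,\boxed{\alpha_0\vee\alpha_1},\Delta\Rightarrow\beta$; $\quad\Gamma\Rightarrow\boxed{\beta_i}\ /\ \Gamma\Rightarrow\boxed{\beta_0\vee\beta_1}$ for $i=0,1$; - $\Gamma,\boxed{\alpha_0},\boxed{\alpha_1},\Delta\Rightarrow\beta\ /\ \Gamma,\boxed{\alpha_0\cdot\alpha_1},\Delta\Rightarrow\beta$; $\quad\Gamma\Rightarrow\boxed{\beta_0};\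 \Delta\Rightarrow\boxed{\beta_1}\ /\ \Gamma,\Delta\Rightarrow\boxed{\beta_0\cdot\beta_1}$; - $\Delta\Rightarrow\boxed{\alpha_0};\ \Gamma,\boxed{\alpha_1},\Sigma\Rightarrow\beta\ /\ \Gamma,\Delta,\boxed{\alpha_0\backslash\alpha_1},\Sigma\Rightarrow\beta$; $\quad\boxed{\beta_0},\Gamma\Rightarrow\boxed{\beta_1}\ /\ \Gamma\Rightarrow\boxed{\beta_0\backslash\beta_1}$; - $\Delta\Rightarrow\boxed{\alpha_0};\ \Gamma,\boxed{\alpha_1},\Sigma\Rightarrow\beta\ /\ \Gamma,\boxed{\alpha_1/\alpha_0},\Delta,\Sigma\Rightarrow\beta$; $\quad\Gamma,\boxed{\beta_0}\Rightarrow\boxed{\beta_1}\ /\ \Gamma\Rightarrow\boxed{\beta_1/\beta_0}$; - $/\ \Rightarrow\boxed{\beta^*}$; $\quad\Gamma\Rightarrow\boxed{\beta};\ \Delta\Rightarrow\boxed{\beta^*}\ /\ \Gamma,\Delta\Rightarrow\boxed{\beta^*}$. Moreover we consider the rules - $*\mathrm L_\omega$: $\ (\Gamma,\boxed{\alpha^{(n)}},\Delta\Rightarrow\beta)_{n\in\mathbb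 N}\ /\ \Gamma,\boxed{\alpha^*},\Delta\Rightarrow\beta$; - $*\mathrm L$: $\ \Gamma,\Delta\Rightarrow\beta;\ \Gamma,\boxed{\alpha},\boxed{\alpha^*},\Delta\Rightarrow\beta\ /\ \Gamma,\boxed{\alpha^*},\Delta\Rightarrow\beta$; - Cut: $\ \Delta\Rightarrow\alpha;\ \Gamma,\alpha,\Pi\Rightarrow\beta\ /\ \Gamma,\Delta,\Pi\Rightarrow\beta$. **Proofs.** A preproof in a set of rules is a possibly non-wellfounded tree whose nodes are labelled by instances of the rules (together with the instantiation), such that the children of a node are exactly its premises. For an instance of a rule, an occurrence $\phi'$ of a formula in a premise is an immediate ancestor of an occurrence $\phi$ in the conclusion if $\phi'$ is auxiliary and $\phi$ is principal, or both instantiate the same formula metavariable, or both lie at the same position in the instantiation of the same sequence metavariable. A thread along an infinite branch of a preproof is a choice of formula occurrences in the sequents of the branch, indexed by a non-empty interval of $\mathbb N$, each of which is an immediate ancestor of the one before. It is progressing if it has a suffix which always stays on the left-hand side, always on the same formula $\alpha^*$, and is principal infinitely often. For a set $\mathcal R$ of schematic rules, the *wellfounded $\omega$-system plus $\mathcal R$*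 has the common rules, $*\mathrm L_\omega$ and the rules of $\mathcal R$; its proofs are the preproofs without infinite branches. The *non-wellfounded system plus $\mathcal R$* has the common rules, $*\mathrm L$ and the rules of $\mathcal R$; its proofs are the preproofs in which every infinite branch has a progressing thread. **Corollary (cut-elimination).** Let $\mathcal R$ be any set of analytic rules. Then both systems plus $\mathcal R$ have cut-elimination: 1. every sequent provable in the wellfounded $\omega$-system plus $\mathcal R\cup\{\mathrm{Cut}\}$ is provable in the wellfounded $\omega$-system plus $\mathcal R$; 2. every sequent provable in the non-wellfounded system plus $\mathcal R\cup\{\mathrm{Cut}\}$ is provable in the non-wellfounded system plus $\mathcal R$. -/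

import Mathlib

namespace ActLat

/-- The absolutely free algebra generated by `V` over the language of action lattices. -/
inductive Term (V : Type) : Type
  | var (x : V) : Term V
  | zero : Term V
  | one : Term V
  | meet (a b : Term V) : Term V
  | join (a b : Term V) : Term V
  | mul (a b : Term V) : Term V
  /-- the left residual `a \ b` -/
  | under (a b : Term V) : Term V
  /-- the right residual `a / b` -/
  | over (a b : Term V) : Term V
  | star (a : Term V) : Term V

/-- The homomorphic extension of a map from variables to terms. -/
def Term.subst {V W : Type} (f : V → Term W) : Term V → Term W
  | .var x => f x
  | .zero => .zero
  | .one => .one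
  | .meet a b => .meet (a.subst f) (b.subst f)
  | .join a b => .join (a.subst f) (b.subst f)
  | .mul a b => .mul (a.subst f) (b.subst f)
  | .under a b => .under (a.subst f) (b.subst f)
  | .over a b => .over (a.subst f) (b.subst f)
  | .star a => .star (a.subst f)

/-- Formulas, over a countably infinite set of propositional variables. -/
abbrev Formula : Type := Term ℕ

/-- Metaformulas, over a countably infinite set of formula metavariables. -/
abbrev MetaFormula : Type := Term ℕ

/-- The sequent `ant ⇒ suc`. -/
structure Sequent : Type where
  ant : List Formula
  suc : Formula

/-- Places where a formula can occur in a sequent: the right-hand side (position `-1`), or a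
position (counted from `0`) on the left-hand side. -/
inductive Occ : Type
  | right : Occ
  | left (i : ℕ) : Occ

/-- The formula of the sequent at a place, if there is one. -/
def Sequent.at (S : Sequent) : Occ → Option Formula
  | .right => some S.suc
  | .left i => S.ant[i]?

/-! ### Rules -/

/-- An instance of a rule: its premises (`prem i` is the `i`-th premise, if there is one), its
conclusion, the principal occurrences of the conclusion, and the immediate ancestor relation:
`anc i o o'` says that the occurrence `o'` in the `i`-th premise is an immediate ancestor of the
occurrence `o` in the conclusion. -/
structure Inference : Type where
  prem : ℕ → Option Sequent
  concl : Sequent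
  principal : Occ → Prop
  anc : ℕ → Occ → Occ → Prop

/-- An entry of the left-hand side of a schematic sequent: a sequence metavariable, or a
metaformula, which may be boxed, i.e. marked as principal (in a conclusion) or as auxiliary
(in a premise). -/
inductive MetaItem : Type
  | seq (X : ℕ) : MetaItem
  | fml (φ : MetaFormula) (boxed : Bool) : MetaItem

/-- A schematic sequent. -/
structure MetaSequent : Type where
  ant : List MetaItem
  suc : MetaFormula
  sucBoxed : Bool

/-- A schematic rule with finitely many premises. -/
structure SchematicRule : Type where
  prems : List MetaSequent
  concl : MetaSequent

/-- A metavariable instantiation. -/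
structure Instantiation : Type where
  fml : ℕ → Formula
  seq : ℕ → List Formula

def MetaItem.inst (σ : Instantiation) : MetaItem → List Formula
  | .seq X => σ.seq X
  | .fml φ _ => [φ.subst σ.fml]

def MetaSequent.inst (σ : Instantiation) (S : MetaSequent) : Sequent where
  ant := S.ant.flatMap (MetaItem.inst σ)
  suc := S.suc.subst σ.fml

/-- Where a formula occurrence of an instantiated sequent comes from: position `j` of the
sequence that instantiates the sequence metavariable `X`, or a metaformula of the schema. -/
inductive Origin : Type
  | seq (X j : ℕ) : Origin
  | fml (φ : MetaFormula) (boxed : Bool) : Origin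

def MetaItem.origins (σ : Instantiation) : MetaItem → List Origin
  | .seq X => (List.range (σ.seq X).length).map (Origin.seq X)
  | .fml φ b => [Origin.fml φ b]

def MetaSequent.originAt (σ : Instantiation) (S : MetaSequent) : Occ → Option Origin
  | .right => some (Origin.fml S.suc S.sucBoxed)
  | .left i => (S.ant.flatMap (MetaItem.origins σ))[i]?

/-- `Origin.Anc o o'`: an occurrence in a premise with origin `o'` is an immediate ancestor of an
occurrence in the conclusion with origin `o`. -/
inductive Origin.Anc : Origin → Origin → Prop
  /-- an auxiliary formula and the principal formula -/
  | boxed (φ φ' : MetaFormula) : Origin.Anc (.fml φ true) (.fml φ' true)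
  /-- both instantiate the same formula metavariable -/
  | fmlVar (x : ℕ) (b b' : Bool) : Origin.Anc (.fml (.var x) b) (.fml (.var x) b')
  /-- both lie at the same position of the instantiation of the same sequence metavariable -/
  | seqVar (X j : ℕ) : Origin.Anc (.seq X j) (.seq X j)

/-- The inference obtained by instantiating a schema with premises `prem` and conclusion
`concl`. -/
def schemaInst (prem : ℕ → Option MetaSequent) (concl : MetaSequent) (σ : Instantiation) :
    Inference where
  prem i := (prem i).map (MetaSequent.inst σ)
  concl := concl.inst σ
  principal o := ∃ φ, concl.originAt σ o = some (.fml φ true)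
  anc i o o' := ∃ S, prem i = some S ∧ ∃ a a', concl.originAt σ o = some a ∧
    S.originAt σ o' = some a' ∧ Origin.Anc a a'

/-- The rule (set of instances) defined by a schematic rule. -/
def SchematicRule.toRule (r : SchematicRule) : Set Inference :=
  Set.range (schemaInst (fun i => r.prems[i]?) r.concl)

/-- Structural rules: right-hand sides are formula metavariables, left-hand sides consist of
formula and sequence metavariables, and no formula is principal or auxiliary. -/
def MetaSequent.IsStructural (S : MetaSequent) : Prop :=
  (∃ x, S.suc = .var x) ∧ S.sucBoxed = false ∧
    ∀ m ∈ S.ant, (∃ X, m = .seq X) ∨ ∃ x, m = .fml (.var x) false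

def SchematicRule.IsStructural (r : SchematicRule) : Prop :=
  (∀ S ∈ r.prems, S.IsStructural) ∧ r.concl.IsStructural

/-- Linear rules: structural rules such that the left-hand side of the conclusion consists of
distinct sequence metavariables. -/
def SchematicRule.IsLinear (r : SchematicRule) : Prop :=
  r.IsStructural ∧ ∃ Xs : List ℕ, Xs.Nodup ∧ r.concl.ant = Xs.map MetaItem.seq

/-- Analytic rules: linear rules of shape
`Γ, Υ₀, Δ ⇒ β  …  Γ, Υₙ₋₁, Δ ⇒ β  /  Γ, Υ, Δ ⇒ β`, where `Υ` is a sequence of sequence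
metavariables and each `Υᵢ` is a sequence of metavariables that appear in `Υ`. -/
def SchematicRule.IsAnalytic (r : SchematicRule) : Prop :=
  r.IsLinear ∧ ∃ (Γ Δ β : ℕ) (U : List ℕ) (Us : List (List ℕ)),
    (∀ V ∈ Us, ∀ X ∈ V, X ∈ U) ∧
    r.prems = Us.map (fun V => ⟨([Γ] ++ V ++ [Δ]).map MetaItem.seq, .var β, false⟩) ∧
    r.concl = ⟨([Γ] ++ U ++ [Δ]).map MetaItem.seq, .var β, false⟩

/-! ### The rules of the calculi

Sequence metavariables: `Γ = seq 0`, `Δ = seq 1`, `Σ = seq 2`.  Formula metavariables: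
`α₀ = var 0`, `α₁ = var 1`, `β = var 2`. -/

/-- The identity axiom `a ⇒ a` for propositional variables `a`. -/
def idRule : Set Inference :=
  {s | ∃ a : ℕ, s = ⟨fun _ => none, ⟨[.var a], .var a⟩, fun _ => False, fun _ _ _ => False⟩}

def zeroL : SchematicRule := ⟨[], ⟨[.seq 0, .fml .zero true, .seq 1], .var 2, false⟩⟩

def oneL : SchematicRule :=
  ⟨[⟨[.seq 0, .seq 1], .var 2, false⟩], ⟨[.seq 0, .fml .one true, .seq 1], .var 2, false⟩⟩

def oneR : SchematicRule := ⟨[], ⟨[], .one, true⟩⟩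

def meetL₀ : SchematicRule :=
  ⟨[⟨[.seq 0, .fml (.var 0) true, .seq 1], .var 2, false⟩],
    ⟨[.seq 0, .fml (.meet (.var 0) (.var 1)) true, .seq 1], .var 2, false⟩⟩

def meetL₁ : SchematicRule :=
  ⟨[⟨[.seq 0, .fml (.var 1) true, .seq 1], .var 2, false⟩],
    ⟨[.seq 0, .fml (.meet (.var 0) (.var 1)) true, .seq 1], .var 2, false⟩⟩

def meetR : SchematicRule :=
  ⟨[⟨[.seq 0], .var 0, true⟩, ⟨[.seq 0], .var 1, true⟩],
    ⟨[.seq 0], .meet (.var 0) (.var 1), true⟩⟩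

def joinL : SchematicRule :=
  ⟨[⟨[.seq 0, .fml (.var 0) true, .seq 1], .var 2, false⟩,
      ⟨[.seq 0, .fml (.var 1) true, .seq 1], .var 2, false⟩],
    ⟨[.seq 0, .fml (.join (.var 0) (.var 1)) true, .seq 1], .var 2, false⟩⟩

def joinR₀ : SchematicRule :=
  ⟨[⟨[.seq 0], .var 0, true⟩], ⟨[.seq 0], .join (.var 0) (.var 1), true⟩⟩

def joinR₁ : SchematicRule :=
  ⟨[⟨[.seq 0], .var 1, true⟩], ⟨[.seq 0], .join (.var 0) (.var 1), true⟩⟩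

def mulL : SchematicRule :=
  ⟨[⟨[.seq 0, .fml (.var 0) true, .fml (.var 1) true, .seq 1], .var 2, false⟩],
    ⟨[.seq 0, .fml (.mul (.var 0) (.var 1)) true, .seq 1], .var 2, false⟩⟩

def mulR : SchematicRule :=
  ⟨[⟨[.seq 0], .var 0, true⟩, ⟨[.seq 1], .var 1, true⟩],
    ⟨[.seq 0, .seq 1], .mul (.var 0) (.var 1), true⟩⟩

def underL : SchematicRule :=
  ⟨[⟨[.seq 1], .var 0, true⟩, ⟨[.seq 0, .fml (.var 1) true, .seq 2], .var 2, false⟩],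
    ⟨[.seq 0, .seq 1, .fml (.under (.var 0) (.var 1)) true, .seq 2], .var 2, false⟩⟩

def overL : SchematicRule :=
  ⟨[⟨[.seq 1], .var 0, true⟩, ⟨[.seq 0, .fml (.var 1) true, .seq 2], .var 2, false⟩],
    ⟨[.seq 0, .fml (.over (.var 1) (.var 0)) true, .seq 1, .seq 2], .var 2, false⟩⟩

def underR : SchematicRule :=
  ⟨[⟨[.fml (.var 0) true, .seq 0], .var 1, true⟩],
    ⟨[.seq 0], .under (.var 0) (.var 1), true⟩⟩

def overR : SchematicRule :=
  ⟨[⟨[.seq 0, .fml (.var 0) true], .var 1, true⟩],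
    ⟨[.seq 0], .over (.var 1) (.var 0), true⟩⟩

def starR₀ : SchematicRule := ⟨[], ⟨[], .star (.var 0), true⟩⟩

def starR₁ : SchematicRule :=
  ⟨[⟨[.seq 0], .var 0, true⟩, ⟨[.seq 1], .star (.var 0), true⟩],
    ⟨[.seq 0, .seq 1], .star (.var 0), true⟩⟩

def starL : SchematicRule :=
  ⟨[⟨[.seq 0, .seq 1], .var 2, false⟩,
      ⟨[.seq 0, .fml (.var 0) true, .fml (.star (.var 0)) true, .seq 1], .var 2, false⟩],
    ⟨[.seq 0, .fml (.star (.var 0)) true, .seq 1], .var 2, false⟩⟩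

/-- The ω-rule: from `Γ, α⁽ⁿ⁾, Δ ⇒ β` for all `n`, infer `Γ, α^*, Δ ⇒ β`. -/
def starLOmega : Set Inference :=
  Set.range (schemaInst
    (fun n => some ⟨[.seq 0] ++ List.replicate n (.fml (.var 0) true) ++ [.seq 1], .var 2, false⟩)
    ⟨[.seq 0, .fml (.star (.var 0)) true, .seq 1], .var 2, false⟩)

/-- The principal rules common to the two systems. -/
def commonRules : Set SchematicRule :=
  {zeroL, oneL, oneR, meetL₀, meetL₁, meetR, joinL, joinR₀, joinR₁, mulL, mulR, underL, overL,
    underR, overR, starR₀, starR₁}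

/-- The cut rule: from `Δ ⇒ α` and `Γ, α, Σ ⇒ β`, infer `Γ, Δ, Σ ⇒ β`. -/
def cut : SchematicRule :=
  ⟨[⟨[.seq 1], .var 0, false⟩, ⟨[.seq 0, .fml (.var 0) false, .seq 2], .var 2, false⟩],
    ⟨[.seq 0, .seq 1, .seq 2], .var 2, false⟩⟩

/-! ### Preproofs, threads and proof systems -/

/-- A possibly non-wellfounded preproof: a tree whose nodes are finite sequences of natural
numbers and carry inferences; `label w = none` means that `w` is not a node.  The last condition
says that `w ++ [i]` is a node iff `w` is a node whose inference has an `i`-th premise, and that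
this premise is then the sequent at `w ++ [i]`. -/
structure Preproof : Type where
  label : List ℕ → Option Inference
  root : (label []).isSome
  step : ∀ (w : List ℕ) (i : ℕ),
    (label (w ++ [i])).map Inference.concl = (label w).bind (fun s => s.prem i)

/-- An infinite branch. -/
def Preproof.IsBranch (π : Preproof) (b : ℕ → List ℕ) : Prop :=
  b 0 = [] ∧ (∀ i, ∃ n, b (i + 1) = b i ++ [n]) ∧ ∀ i, (π.label (b i)).isSome

/-- `t`, restricted to the non-empty interval `I`, is a thread in `(π, b)`. -/
def Preproof.IsThread (π : Preproof) (b : ℕ → List ℕ) (I : Set ℕ) (t : ℕ → Occ) : Prop :=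
  I.Nonempty ∧ I.OrdConnected ∧
    (∀ i ∈ I, ∃ s, π.label (b i) = some s ∧ (s.concl.at (t i)).isSome) ∧
    ∀ i ∈ I, i + 1 ∈ I →
      ∃ s n, π.label (b i) = some s ∧ b (i + 1) = b i ++ [n] ∧ s.anc n (t i) (t (i + 1))

/-- A thread that always stays on the left-hand side, on one and the same formula `α^*`. -/
def Preproof.IsStarThread (π : Preproof) (b : ℕ → List ℕ) (I : Set ℕ) (t : ℕ → Occ) : Prop :=
  π.IsThread b I t ∧ ∃ α : Formula, ∀ i ∈ I, t i ≠ .right ∧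
    ∃ s, π.label (b i) = some s ∧ s.concl.at (t i) = some (.star α)

/-- The thread `(I', t')` is a suffix of the thread `(I, t)`. -/
def IsThreadSuffix (I' : Set ℕ) (t' : ℕ → Occ) (I : Set ℕ) (t : ℕ → Occ) : Prop :=
  I' ⊆ I ∧ (∀ i ∈ I', ∀ j ∈ I, i ≤ j → j ∈ I') ∧ ∀ i ∈ I', t' i = t i

/-- The thread `(I, t)` is progressing: some suffix of it is a star-thread that is principal
infinitely often. -/
def Preproof.IsProgressingThread (π : Preproof) (b : ℕ → List ℕ) (I : Set ℕ) (t : ℕ → Occ) :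
    Prop :=
  π.IsThread b I t ∧ ∃ (I' : Set ℕ) (t' : ℕ → Occ), IsThreadSuffix I' t' I t ∧
    π.IsStarThread b I' t' ∧
    {i | i ∈ I' ∧ ∃ s, π.label (b i) = some s ∧ s.principal (t' i)}.Infinite

/-- A proof system: its rules (each given as the set of its instances) and its condition on the
infinite branches of preproofs. -/
structure ProofSystem : Type where
  rules : Set (Set Inference)
  branchCond : Preproof → (ℕ → List ℕ) → Prop

/-- A proof of `S`: a preproof with root sequent `S`, all of whose inferences are instances of
rules of the system and all of whose infinite branches satisfy the branch condition. -/
def ProofSystem.IsProof (G : ProofSystem) (π : Preproof) (S : Sequent) : Prop :=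
  (π.label []).map Inference.concl = some S ∧
    (∀ w s, π.label w = some s → ∃ ρ ∈ G.rules, s ∈ ρ) ∧
    ∀ b, π.IsBranch b → G.branchCond π b

def ProofSystem.Provable (G : ProofSystem) (S : Sequent) : Prop :=
  ∃ π : Preproof, G.IsProof π S

/-- The wellfounded system with the ω-rule, extended by the schematic rules in `R`: there are
no infinite branches. -/
def omegaSystem (R : Set SchematicRule) : ProofSystem where
  rules := {idRule, starLOmega} ∪ SchematicRule.toRule '' commonRules ∪ SchematicRule.toRule '' R
  branchCond _ _ := False

/-- The non-wellfounded system, extended by the schematic rules in `R`: every infinite branch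
has a progressing thread. -/
def nwfSystem (R : Set SchematicRule) : ProofSystem where
  rules := {idRule, starL.toRule} ∪ SchematicRule.toRule '' commonRules ∪
    SchematicRule.toRule '' R
  branchCond π b := ∃ I t, π.IsProgressingThread b I t

end ActLat

namespace ActLat

/-! ### From the ω-rule to non-wellfounded proofs -/

/-! Both statements follow from a chain of inclusions between sets of provable sequents: ω-system
with cut ⊆ non-wellfounded system with cut ⊆ ω-system without cut ⊆ non-wellfounded system without
cut.

The outer two are the same syntactic translation, `nwfSystem_provable_of_omegaSystem`. Each ω-rule
instance becomes an infinite spine of `starL` instances, whose exits are the premises of the ω-rule.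
Since the original proof is wellfounded, an infinite branch of the result eventually stays in one
spine, where the star is principal at every step.

The middle inclusion, `omegaSystem_provable_of_nwfSystem_cut`, is semantic. Cut-free ω-provability
induces a Galois connection, and formulas are interpreted by closed sets of formula sequences. By
induction on α, `[α] ∈ val α` and every element of `val α` proves α (`val_spec`), so a sequent valid
in this algebra is provable without cut. Cut is sound because both occurrences of the cut formula
denote the same closed set; an analytic rule is sound because its context metavariables absorb the
contexts over which closure quantifies.

Soundness of a non-wellfounded proof cannot be shown by induction, so failure is propagated upwards.
Each formula on the left is replaced by a witness from its value; for γ^* the witness lies in a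
definite power n of the value of γ, since the powers generate the closed set. A failing conclusion
has a failing premise, with n never increasing along a star-thread and dropping where the star is
principal (`StepSound`). A progressing thread on the resulting failing branch would be an infinite
descent in ℕ. -/

theorem exists_seq_of_forall_exists {T : Type} {r : T → T → Prop} (a : T)
    (h : ∀ t, ∃ t', r t t') : ∃ f : ℕ → T, f 0 = a ∧ ∀ i, r (f i) (f (i + 1)) := by
  choose g hg using h
  exact ⟨fun i => Nat.rec a (fun _ t => g t) i, rfl, fun i => hg _⟩

/-- The child relation on the nodes of a preproof. -/
def Preproof.Child (π : Preproof) (w' w : List ℕ) : Prop :=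
  (π.label w').isSome ∧ ∃ n, w' = w ++ [n]

/-- If the root were not accessible, one could choose inaccessible children forever, which is an
infinite branch. -/
theorem Preproof.acc_root (π : Preproof) (h : ∀ b, ¬ π.IsBranch b) : Acc π.Child [] := by
  by_contra hroot
  obtain ⟨f, hf0, hf⟩ := exists_seq_of_forall_exists
    (T := {w : List ℕ // ¬ Acc π.Child w ∧ (π.label w).isSome})
    (r := fun t t' => π.Child t'.1 t.1) ⟨[], hroot, π.root⟩ (by
      rintro ⟨w, hw, hs⟩
      obtain ⟨w', hw', hc⟩ := exists_not_acc_lt_of_not_acc hw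
      exact ⟨⟨w', hw', hc.1⟩, hc⟩)
  refine h (fun i => (f i).1) ⟨by simp [hf0], fun i => (hf i).2, fun i => (f i).2.2⟩

/-- A sequence of nodes that is at each step constant or passes to a child is eventually
constant, if it starts at an accessible node. -/
theorem eventually_const_of_acc {T : Type} {r : T → T → Prop} {w : T} (hw : Acc r w)
    (u : ℕ → T) (hu : ∀ i, u (i + 1) = u i ∨ r (u (i + 1)) (u i)) (i : ℕ) (hi : u i = w) :
    ∃ N, ∀ j, N ≤ j → u j = u N := by
  induction hw generalizing i with
  | intro w _ ih =>
    by_cases hc : ∀ j, i ≤ j → u j = u i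
    · exact ⟨i, hc⟩
    · have hex : ∃ j, i ≤ j ∧ u j ≠ u i := by
        by_contra hne
        exact hc fun j hj => by
          by_contra hji
          exact hne ⟨j, hj, hji⟩
      classical
      obtain ⟨hj, hji⟩ := Nat.find_spec hex
      have hmin := fun k => Nat.find_min hex (m := k)
      generalize Nat.find hex = j at hj hji hmin
      obtain rfl | hlt := hj.eq_or_lt
      · exact absurd rfl hji
      · obtain ⟨k, rfl⟩ : ∃ k, j = k + 1 := ⟨j - 1, by omega⟩
        have hk : u k = u i := by
          by_contra hne
          exact hmin k (Nat.lt_succ_self k) ⟨by omega, hne⟩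
        rcases hu k with h | h
        · exact absurd (h.trans hk) hji
        · rw [hk, hi] at h
          exact ih _ h _ rfl

/-! ### The spine of `starL` instances that simulates the ω-rule -/

/-- The instance of `starLOmega` given by a metavariable instantiation. -/
def omegaInst (σ : Instantiation) : Inference :=
  schemaInst
    (fun n => some ⟨[.seq 0] ++ List.replicate n (.fml (.var 0) true) ++ [.seq 1], .var 2, false⟩)
    ⟨[.seq 0, .fml (.star (.var 0)) true, .seq 1], .var 2, false⟩ σ

/-- The instantiation that replaces `Γ` by `Γ, α⁽ᵏ⁾`. -/
def Instantiation.unfold (σ : Instantiation) (k : ℕ) : Instantiation where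
  fml := σ.fml
  seq X := if X = 0 then σ.seq 0 ++ List.replicate k (σ.fml 0) else σ.seq X

/-- The `k`-th instance of `starL` in the translation of an instance of `starLOmega`. -/
def unfoldInst (σ : Instantiation) (k : ℕ) : Inference :=
  schemaInst (fun i => starL.prems[i]?) starL.concl (σ.unfold k)

theorem unfoldInst_concl (σ : Instantiation) (k : ℕ) : (unfoldInst σ k).concl =
    ⟨σ.seq 0 ++ List.replicate k (σ.fml 0) ++ [.star (σ.fml 0)] ++ σ.seq 1, σ.fml 2⟩ := by
  simp [unfoldInst, schemaInst, starL, MetaSequent.inst, MetaItem.inst, Instantiation.unfold,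
    Term.subst]

theorem omegaInst_concl (σ : Instantiation) : (omegaInst σ).concl = (unfoldInst σ 0).concl := by
  rw [unfoldInst_concl]
  simp [omegaInst, schemaInst, MetaSequent.inst, MetaItem.inst, Term.subst]

theorem omegaInst_prem (σ : Instantiation) (k : ℕ) : (omegaInst σ).prem k =
    some ⟨σ.seq 0 ++ List.replicate k (σ.fml 0) ++ σ.seq 1, σ.fml 2⟩ := by
  have h : (List.replicate k (MetaItem.fml (.var 0) true)).flatMap (MetaItem.inst σ) =
      List.replicate k (σ.fml 0) := by
    induction k with
    | zero => rfl
    | succ k ih => simp [List.replicate_succ, ih, MetaItem.inst, Term.subst]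
  simp [omegaInst, schemaInst, MetaSequent.inst, h, Term.subst]
  simp [MetaItem.inst]

theorem unfoldInst_prem_zero (σ : Instantiation) (k : ℕ) :
    (unfoldInst σ k).prem 0 = (omegaInst σ).prem k := by
  rw [omegaInst_prem]
  simp [unfoldInst, schemaInst, starL, MetaSequent.inst, MetaItem.inst, Instantiation.unfold,
    Term.subst]

theorem unfoldInst_prem_one (σ : Instantiation) (k : ℕ) :
    (unfoldInst σ k).prem 1 = some (unfoldInst σ (k + 1)).concl := by
  rw [unfoldInst_concl, List.replicate_succ']
  simp [unfoldInst, schemaInst, starL, MetaSequent.inst, MetaItem.inst, Instantiation.unfold,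
    Term.subst]

theorem unfoldInst_prem_add_two (σ : Instantiation) (k i : ℕ) :
    (unfoldInst σ k).prem (i + 2) = none := by
  simp [unfoldInst, schemaInst, starL]

theorem unfoldInst_concl_at (σ : Instantiation) (k : ℕ) :
    (unfoldInst σ k).concl.at (.left ((σ.seq 0).length + k)) = some (.star (σ.fml 0)) := by
  rw [unfoldInst_concl]
  simp [Sequent.at]

theorem starL_concl_originAt (σ : Instantiation) (k : ℕ) :
    starL.concl.originAt (σ.unfold k) (.left ((σ.seq 0).length + k)) =
      some (.fml (.star (.var 0)) true) := by
  simp [starL, MetaSequent.originAt, MetaItem.origins, Instantiation.unfold]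

theorem unfoldInst_principal (σ : Instantiation) (k : ℕ) :
    (unfoldInst σ k).principal (.left ((σ.seq 0).length + k)) :=
  ⟨_, starL_concl_originAt σ k⟩

/-- After k unfoldings the star stands behind Γ and k copies of α. In the right premise it is
preceded by one more copy, hence the shift by one. -/
theorem unfoldInst_anc (σ : Instantiation) (k : ℕ) :
    (unfoldInst σ k).anc 1 (.left ((σ.seq 0).length + k))
      (.left ((σ.seq 0).length + (k + 1))) := by
  refine ⟨_, rfl, _, _, starL_concl_originAt σ k, ?_, .boxed _ (.star (.var 0))⟩
  have h : (σ.seq 0).length + (k + 1) - ((σ.seq 0).length + k) = 1 := by omega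
  simp [MetaSequent.originAt, MetaItem.origins, Instantiation.unfold, List.getElem?_append, h]

/-! ### The translated preproof -/

open Classical in
/-- The inference at a state of the translation of `π`: a node of `π`, and the number of
unfoldings of the star if the node carries an instance of `starLOmega`. -/
noncomputable def Preproof.unfoldLabel (π : Preproof) (t : List ℕ × ℕ) : Option Inference :=
  (π.label t.1).map fun s => if h : ∃ σ, s = omegaInst σ then unfoldInst h.choose t.2 else s

open Classical in
/-- The states that follow a state of the translation of `π`. -/
noncomputable def Preproof.unfoldNext (π : Preproof) (t : List ℕ × ℕ) (i : ℕ) :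
    Option (List ℕ × ℕ) :=
  if ∃ σ, π.label t.1 = some (omegaInst σ) then
    match i with
    -- The left premise of the k-th unfolding is the k-th premise of the ω-rule, so the counter
    -- becomes the child index.
    | 0 => some (t.1 ++ [t.2], 0)
    | 1 => some (t.1, t.2 + 1)
    | _ + 2 => none
  -- This address need not be a node of π; `unfoldLabel` is then `none`.
  else some (t.1 ++ [i], 0)

/-- The state reached by following an address from the root. It is `none` only if the address asks
for a third premise inside a spine. -/
noncomputable def Preproof.unfoldRun (π : Preproof) (w : List ℕ) : Option (List ℕ × ℕ) :=
  w.foldl (fun o i => o.bind fun t => π.unfoldNext t i) (some ([], 0))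

theorem Preproof.unfoldRun_append (π : Preproof) (w : List ℕ) (i : ℕ) :
    π.unfoldRun (w ++ [i]) = (π.unfoldRun w).bind fun t => π.unfoldNext t i := by
  simp [Preproof.unfoldRun]

/-- The chosen instantiation depends on the node of π but not on the counter, so a single σ serves
the whole spine. -/
theorem Preproof.unfoldLabel_of_omega {π : Preproof} {w : List ℕ}
    (h : ∃ σ, π.label w = some (omegaInst σ)) :
    ∃ σ, π.label w = some (omegaInst σ) ∧
      ∀ k, π.unfoldLabel (w, k) = some (unfoldInst σ k) := by
  obtain ⟨σ, hσ⟩ := h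
  have h : ∃ σ', omegaInst σ = omegaInst σ' := ⟨σ, rfl⟩
  refine ⟨h.choose, hσ.trans (congrArg some h.choose_spec), fun k => ?_⟩
  simp only [Preproof.unfoldLabel, hσ, Option.map_some]
  rw [dif_pos h]

theorem Preproof.unfoldLabel_of_not_omega {π : Preproof} {w : List ℕ}
    (h : ¬ ∃ σ, π.label w = some (omegaInst σ)) (k : ℕ) :
    π.unfoldLabel (w, k) = π.label w := by
  unfold Preproof.unfoldLabel
  cases hs : π.label w with
  | none => rfl
  | some s =>
    simp only [hs, Option.some.injEq] at h
    simp [h]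

theorem Preproof.unfoldLabel_concl (π : Preproof) (w : List ℕ) :
    (π.unfoldLabel (w, 0)).map Inference.concl = (π.label w).map Inference.concl := by
  by_cases h : ∃ σ, π.label w = some (omegaInst σ)
  · obtain ⟨σ, hσ, hl⟩ := Preproof.unfoldLabel_of_omega h
    simp [hl, hσ, omegaInst_concl]
  · rw [Preproof.unfoldLabel_of_not_omega h]

theorem Preproof.unfoldLabel_step (π : Preproof) (t : List ℕ × ℕ) (i : ℕ) :
    ((π.unfoldNext t i).bind π.unfoldLabel).map Inference.concl =
      (π.unfoldLabel t).bind fun s => s.prem i := by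
  obtain ⟨w, k⟩ := t
  by_cases h : ∃ σ, π.label w = some (omegaInst σ)
  · obtain ⟨σ, hσ, hl⟩ := Preproof.unfoldLabel_of_omega h
    rw [hl]
    match i with
    | 0 =>
      simp only [Preproof.unfoldNext, h, if_true, Option.bind_some]
      rw [π.unfoldLabel_concl, π.step, hσ, Option.bind_some, unfoldInst_prem_zero]
    | 1 => simp [Preproof.unfoldNext, h, hl, unfoldInst_prem_one]
    | i + 2 => simp [Preproof.unfoldNext, h, unfoldInst_prem_add_two]
  · rw [Preproof.unfoldLabel_of_not_omega h]
    simp only [Preproof.unfoldNext, h, if_false, Option.bind_some]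
    rw [π.unfoldLabel_concl, π.step]

/-- The translation of a preproof that replaces each instance of `starLOmega` by an infinite
sequence of instances of `starL`. -/
noncomputable def Preproof.unfold (π : Preproof) : Preproof where
  label w := (π.unfoldRun w).bind π.unfoldLabel
  root := by
    have h := π.unfoldLabel_concl []
    have h' := π.root
    rw [← Option.isSome_map (f := Inference.concl), ← h, Option.isSome_map] at h'
    exact h'
  step w i := by
    rw [π.unfoldRun_append]
    cases π.unfoldRun w with
    | none => rfl
    | some t => exact π.unfoldLabel_step t i

/-- Every step of a branch either climbs a spine or passes to a child in π. The second happens only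
finitely often because π is wellfounded, and the star of the final spine carries the thread. -/
theorem Preproof.unfold_isProgressing (π : Preproof) (hπ : ∀ b, ¬ π.IsBranch b)
    (b : ℕ → List ℕ) (hb : π.unfold.IsBranch b) : ∃ I t, π.unfold.IsProgressingThread b I t := by
  obtain ⟨hb0, hbs, hbl⟩ := hb
  have hrun : ∀ i, ∃ t, π.unfoldRun (b i) = some t := fun i => by
    have := hbl i
    cases h : π.unfoldRun (b i) with
    | none => simp [Preproof.unfold, h] at this
    | some t => exact ⟨t, rfl⟩
  choose t ht using hrun
  have hlab : ∀ i, π.unfold.label (b i) = π.unfoldLabel (t i) := fun i => by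
    simp [Preproof.unfold, ht i]
  choose d hd using hbs
  have hnext : ∀ i, π.unfoldNext (t i) (d i) = some (t (i + 1)) := fun i => by
    have := ht (i + 1)
    rwa [hd i, π.unfoldRun_append, ht i] at this
  have hnode : ∀ i, (π.label (t i).1).isSome := fun i => by
    have := hbl i
    rw [hlab, Preproof.unfoldLabel, Option.isSome_map] at this
    exact this
  have hcases : ∀ i, ((∃ σ, π.label (t i).1 = some (omegaInst σ)) ∧ d i = 1 ∧
      t (i + 1) = ((t i).1, (t i).2 + 1)) ∨ ∃ n, (t (i + 1)).1 = (t i).1 ++ [n] := fun i => by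
    have hn := hnext i
    by_cases h : ∃ σ, π.label (t i).1 = some (omegaInst σ)
    · generalize d i = m at hn
      match m with
      | 0 =>
        simp only [Preproof.unfoldNext, h, if_true, Option.some.injEq] at hn
        exact .inr ⟨(t i).2, by rw [← hn]⟩
      | 1 =>
        simp only [Preproof.unfoldNext, h, if_true, Option.some.injEq] at hn
        exact .inl ⟨h, rfl, hn.symm⟩
      | m + 2 => simp [Preproof.unfoldNext, h] at hn
    · simp only [Preproof.unfoldNext, h, if_false, Option.some.injEq] at hn
      exact .inr ⟨d i, by rw [← hn]⟩
  have ht0 : t 0 = ([], 0) := by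
    have := ht 0
    rw [hb0] at this
    exact (Option.some.inj this).symm
  obtain ⟨N, hN⟩ := eventually_const_of_acc (π.acc_root hπ) (fun i => (t i).1) (fun i => by
    rcases hcases i with ⟨-, -, h⟩ | h
    · exact .inl (by rw [h])
    · exact .inr ⟨hnode _, h⟩) 0 (by simp [ht0])
  -- From N on the node of π is constant, which excludes passing to a child: no list equals itself
  -- with an entry appended.
  have hspine : ∀ i, N ≤ i → (∃ σ, π.label (t i).1 = some (omegaInst σ)) ∧ d i = 1 ∧
      t (i + 1) = ((t i).1, (t i).2 + 1) := fun i hi => by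
    rcases hcases i with h | ⟨n, h⟩
    · exact h
    · have h1 := hN i hi
      have h2 := hN (i + 1) (by omega)
      rw [h1, h2] at h
      simp at h
  obtain ⟨σ, -, hσ⟩ := Preproof.unfoldLabel_of_omega (hspine N le_rfl).1
  have hl : ∀ i, N ≤ i → π.unfold.label (b i) = some (unfoldInst σ (t i).2) := fun i hi => by
    have h1 := hN i hi
    rw [hlab, ← hσ, ← h1]
  let T : ℕ → Occ := fun i => .left ((σ.seq 0).length + (t i).2)
  have hth : π.unfold.IsThread b (Set.Ici N) T := by
    refine ⟨⟨N, Set.mem_Ici.2 le_rfl⟩, Set.ordConnected_Ici, fun i hi => ?_, fun i hi _ => ?_⟩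
    · exact ⟨_, hl i hi, by rw [unfoldInst_concl_at]; rfl⟩
    · obtain ⟨-, h1, h2⟩ := hspine i hi
      refine ⟨_, 1, hl i hi, by rw [hd i, h1], ?_⟩
      simp only [T, h2]
      exact unfoldInst_anc σ _
  refine ⟨Set.Ici N, T, hth, Set.Ici N, T, ⟨subset_rfl, fun i hi j _ hij => le_trans hi hij,
    fun _ _ => rfl⟩, ⟨hth, σ.fml 0, fun i hi => ⟨by simp [T], _, hl i hi,
      unfoldInst_concl_at σ _⟩⟩, ?_⟩
  refine (Set.Ici_infinite N).mono fun i hi => ⟨hi, _, hl i hi, unfoldInst_principal σ _⟩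

/-- Here R is arbitrary, so this applies both with and without cut. -/
theorem nwfSystem_provable_of_omegaSystem {R : Set SchematicRule} {S : Sequent}
    (h : (omegaSystem R).Provable S) : (nwfSystem R).Provable S := by
  obtain ⟨π, hroot, hrules, hbr⟩ := h
  refine ⟨π.unfold, (π.unfoldLabel_concl []).trans hroot, fun w s hs => ?_,
    fun b hb => π.unfold_isProgressing hbr b hb⟩
  obtain ⟨⟨u, k⟩, -, ht⟩ := Option.bind_eq_some_iff.1 hs
  by_cases ho : ∃ σ, π.label u = some (omegaInst σ)
  · obtain ⟨σ, -, hσ⟩ := Preproof.unfoldLabel_of_omega ho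
    rw [hσ] at ht
    exact ⟨starL.toRule, by simp [nwfSystem], σ.unfold k, Option.some.inj ht⟩
  · rw [Preproof.unfoldLabel_of_not_omega ho] at ht
    obtain ⟨ρ, hρ, hsρ⟩ := hrules u s ht
    rcases hρ with ((rfl | rfl) | hρ) | hρ
    · exact ⟨idRule, by simp [nwfSystem], hsρ⟩
    · obtain ⟨σ, rfl⟩ := hsρ
      exact absurd ⟨σ, ht⟩ ho
    · exact ⟨ρ, .inl (.inr hρ), hsρ⟩
    · exact ⟨ρ, .inr hρ, hsρ⟩

/-! ### Closure of the ω-system under its rules -/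

/-- Proofs of the premises are glued below a new root. An infinite branch, with its first entry
removed, would be one in the proof of a premise. -/
theorem omegaSystem_provable_of_mem {R : Set SchematicRule} {ρ : Set Inference} {s : Inference}
    (hρ : ρ ∈ (omegaSystem R).rules) (hs : s ∈ ρ)
    (h : ∀ i S, s.prem i = some S → (omegaSystem R).Provable S) :
    (omegaSystem R).Provable s.concl := by
  have h' : ∀ i, ∃ π : Preproof, ∀ S, s.prem i = some S → (omegaSystem R).IsProof π S := fun i => by
    cases hi : s.prem i with
    | none => exact ⟨⟨fun w => if w = [] then some ⟨fun _ => none, s.concl, fun _ => False,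
        fun _ _ _ => False⟩ else none, rfl, fun w i => by by_cases hw : w = [] <;> simp [hw]⟩,
        by simp⟩
    | some S =>
      obtain ⟨π, hπ⟩ := h i S hi
      exact ⟨π, by simpa using hπ⟩
  choose π hπ using h'
  let l : List ℕ → Option Inference := fun w => match w with
    | [] => some s
    | i :: w => (s.prem i).bind fun _ => (π i).label w
  refine ⟨⟨l, rfl, fun w i => ?_⟩, rfl, fun w s' hw => ?_, fun b hb => ?_⟩
  · cases w with
    | nil =>
      cases hi : s.prem i with
      | none => simp [l, hi]
      | some S => simpa [l, hi] using (hπ i S hi).1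
    | cons j w =>
      cases hj : s.prem j with
      | none => simp [l, hj]
      | some S => simpa [l, hj] using (π j).step w i
  · cases w with
    | nil =>
      obtain rfl : s = s' := Option.some.inj hw
      exact ⟨ρ, hρ, hs⟩
    | cons j w =>
      cases hj : s.prem j with
      | none => simp [l, hj] at hw
      | some S => exact (hπ j S hj).2.1 w s' (by simpa [l, hj] using hw)
  · obtain ⟨hb0, hbs, hbl⟩ := hb
    obtain ⟨n, hn⟩ := hbs 0
    have hc : ∀ i, ∃ w, b (i + 1) = n :: w := fun i => by
      induction i with
      | zero => exact ⟨[], by simp [hn, hb0]⟩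
      | succ i ih =>
        obtain ⟨w, hw⟩ := ih
        obtain ⟨m, hm⟩ := hbs (i + 1)
        exact ⟨w ++ [m], by simp [hm, hw]⟩
    choose c hc using hc
    have hl : ∀ i, (l (n :: c i)).isSome := fun i => hc i ▸ hbl (i + 1)
    cases hS : s.prem n with
    | none => simpa [l, hS] using hl 0
    | some S =>
      refine (hπ n S hS).2.2 c ⟨?_, fun i => ?_, fun i => by simpa [l, hS] using hl i⟩
      · have := hc 0
        rw [hn, hb0] at this
        simpa using this.symm
      · obtain ⟨m, hm⟩ := hbs (i + 1)
        rw [hc, hc] at hm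
        exact ⟨m, by simpa using hm⟩

theorem omegaSystem_provable_schema {R : Set SchematicRule} {r : SchematicRule}
    (hr : r ∈ commonRules ∪ R) (σ : Instantiation)
    (h : ∀ S ∈ r.prems, (omegaSystem R).Provable (S.inst σ)) :
    (omegaSystem R).Provable (r.concl.inst σ) := by
  refine omegaSystem_provable_of_mem (ρ := r.toRule)
    (s := schemaInst (fun i => r.prems[i]?) r.concl σ) ?_ ⟨σ, rfl⟩ fun i S hS => ?_
  · rcases hr with hr | hr
    · exact .inl (.inr ⟨r, hr, rfl⟩)
    · exact .inr ⟨r, hr, rfl⟩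
  · simp only [schemaInst, Option.map_eq_some_iff] at hS
    obtain ⟨S', hS', rfl⟩ := hS
    exact h S' (List.mem_of_getElem? hS')

theorem omegaSystem_provable_starL {R : Set SchematicRule} {Γ Δ : List Formula} {α β : Formula}
    (h : ∀ n, (omegaSystem R).Provable ⟨Γ ++ List.replicate n α ++ Δ, β⟩) :
    (omegaSystem R).Provable ⟨Γ ++ [.star α] ++ Δ, β⟩ := by
  let σ : Instantiation := ⟨fun x => if x = 0 then α else β, fun X => if X = 0 then Γ else Δ⟩
  have key := omegaSystem_provable_of_mem (R := R) (ρ := starLOmega) (by simp [omegaSystem])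
    ⟨σ, rfl⟩ (fun n S hS => ?_)
  · simpa [schemaInst, MetaSequent.inst, MetaItem.inst, Term.subst, σ] using key
  · have hrep : (List.replicate n (MetaItem.fml (.var 0) true)).flatMap (MetaItem.inst σ) =
        List.replicate n α := by
      clear hS
      induction n with
      | zero => rfl
      | succ k ih => simpa [List.replicate_succ, MetaItem.inst, Term.subst, σ] using ih
    simp only [schemaInst, Option.map_some, Option.some.injEq] at hS
    subst hS
    have := h n
    rw [List.append_assoc] at this
    simpa [MetaSequent.inst, hrep, MetaItem.inst, Term.subst, σ] using this

/-! ### Closed sets of sequences of formulas -/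

/-- The closure of `A` under the Galois connection given by a set `P` of sequents. -/
def cl (P : Sequent → Prop) (A : Set (List Formula)) : Set (List Formula) :=
  {x | ∀ Γ Δ β, (∀ y ∈ A, P ⟨Γ ++ y ++ Δ, β⟩) → P ⟨Γ ++ x ++ Δ, β⟩}

theorem subset_cl (P : Sequent → Prop) (A : Set (List Formula)) : A ⊆ cl P A :=
  fun _ hx _ _ _ h => h _ hx

def IsCl (P : Sequent → Prop) (A : Set (List Formula)) : Prop := cl P A ⊆ A

theorem isCl_cl (P : Sequent → Prop) (A : Set (List Formula)) : IsCl P (cl P A) :=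
  fun _ hx Γ Δ β h => hx Γ Δ β fun _ hy => hy Γ Δ β h

theorem isCl_provable (P : Sequent → Prop) (β : Formula) : IsCl P {x | P ⟨x, β⟩} :=
  fun x hx => by simpa using hx [] [] β (by simp)

/-- Closure quantifies over all contexts, so g and d can be moved into them. Thus membership of a
concatenation in a closed set can be tested on generators of one factor. -/
theorem IsCl.append {P : Sequent → Prop} {C A : Set (List Formula)} (hC : IsCl P C)
    {g d x : List Formula} (hx : x ∈ cl P A) (h : ∀ y ∈ A, g ++ y ++ d ∈ C) :
    g ++ x ++ d ∈ C := by
  refine hC fun Γ Δ β hP => ?_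
  have := hx (Γ ++ g) (d ++ Δ) β fun y hy => by simpa using hP _ (h y hy)
  simpa using this

/-- The elements of `A ^ n`. -/
def pw (A : Set (List Formula)) : ℕ → Set (List Formula)
  | 0 => {[]}
  | n + 1 => {z | ∃ x ∈ A, ∃ y ∈ pw A n, z = x ++ y}

/-- The value of a formula in the algebra of closed sets. -/
def val (P : Sequent → Prop) : Formula → Set (List Formula)
  | .var a => {x | P ⟨x, .var a⟩}
  | .zero => cl P ∅
  | .one => cl P {[]}
  | .meet a b => val P a ∩ val P b
  | .join a b => cl P (val P a ∪ val P b)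
  | .mul a b => cl P {z | ∃ x ∈ val P a, ∃ y ∈ val P b, z = x ++ y}
  | .under a b => {x | ∀ y ∈ val P a, y ++ x ∈ val P b}
  | .over a b => {x | ∀ y ∈ val P b, x ++ y ∈ val P a}
  | .star a => cl P (⋃ n, pw (val P a) n)

theorem isCl_val (P : Sequent → Prop) (α : Formula) : IsCl P (val P α) := by
  induction α with
  | var a => exact isCl_provable P _
  | zero => exact isCl_cl P _
  | one => exact isCl_cl P _
  | meet a b iha ihb =>
    exact fun x hx => ⟨iha fun Γ Δ β h => hx Γ Δ β fun y hy => h y hy.1,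
      ihb fun Γ Δ β h => hx Γ Δ β fun y hy => h y hy.2⟩
  | join a b => exact isCl_cl P _
  | mul a b => exact isCl_cl P _
  | under a b iha ihb =>
    intro x hx y hy
    simpa using ihb.append (g := y) (d := []) hx fun z hz => by simpa using hz y hy
  | star a => exact isCl_cl P _
  | _ a b iha ihb =>
    intro x hx y hy
    simpa using iha.append (g := []) (d := y) hx fun z hz => by simpa using hz y hy

/-- The left rules give the first half and the right rules the second. Identity is needed for
variables only, and cut nowhere. -/
theorem val_spec {R : Set SchematicRule} (α : Formula) :
    [α] ∈ val (omegaSystem R).Provable α ∧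
      ∀ x ∈ val (omegaSystem R).Provable α, (omegaSystem R).Provable ⟨x, α⟩ := by
  have rule : ∀ r ∈ commonRules, ∀ σ : Instantiation,
      (∀ S ∈ r.prems, (omegaSystem R).Provable (S.inst σ)) →
      (omegaSystem R).Provable (r.concl.inst σ) :=
    fun r hr σ h => omegaSystem_provable_schema (.inl hr) σ h
  -- Slots that a rule does not use are filled arbitrarily below.
  let σ (a b c : Formula) (Γ Δ Θ : List Formula) : Instantiation :=
    ⟨fun | 0 => a | 1 => b | _ => c, fun | 0 => Γ | 1 => Δ | _ => Θ⟩
  induction α with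
  | var a =>
    refine ⟨?_, fun x hx => hx⟩
    exact omegaSystem_provable_of_mem (R := R) (ρ := idRule) (by simp [omegaSystem]) ⟨a, rfl⟩
      (by simp)
  | zero =>
    have key : [.zero] ∈ cl (omegaSystem R).Provable ∅ := fun Γ Δ β _ => by
      simpa [zeroL, MetaSequent.inst, MetaItem.inst, Term.subst, σ] using
        rule zeroL (by simp [commonRules]) (σ .zero .zero β Γ Δ []) (by simp [zeroL])
    exact ⟨key, fun x hx => isCl_provable _ _ fun Γ Δ β h => hx Γ Δ β (by simp)⟩
  | one =>
    refine ⟨fun Γ Δ β h => ?_, fun x hx => isCl_provable _ _ fun Γ Δ β h => hx Γ Δ β ?_⟩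
    · simpa [oneL, MetaSequent.inst, MetaItem.inst, Term.subst, σ] using
        rule oneL (by simp [commonRules]) (σ .zero .zero β Γ Δ []) (by
          simpa [oneL, MetaSequent.inst, MetaItem.inst, Term.subst, σ] using h)
    · rintro _ rfl
      refine h _ ?_
      simpa [oneR, MetaSequent.inst, MetaItem.inst, Term.subst, σ] using
        rule oneR (by simp [commonRules]) (σ .zero .zero .zero [] [] []) (by simp [oneR])
  | meet a b iha ihb =>
    refine ⟨⟨isCl_val _ _ fun Γ Δ β h => ?_, isCl_val _ _ fun Γ Δ β h => ?_⟩, fun x hx => ?_⟩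
    · simpa [meetL₀, MetaSequent.inst, MetaItem.inst, Term.subst, σ] using
        rule meetL₀ (by simp [commonRules]) (σ a b β Γ Δ []) (by
          simpa [meetL₀, MetaSequent.inst, MetaItem.inst, Term.subst, σ] using h _ iha.1)
    · simpa [meetL₁, MetaSequent.inst, MetaItem.inst, Term.subst, σ] using
        rule meetL₁ (by simp [commonRules]) (σ a b β Γ Δ []) (by
          simpa [meetL₁, MetaSequent.inst, MetaItem.inst, Term.subst, σ] using h _ ihb.1)
    · simpa [meetR, MetaSequent.inst, MetaItem.inst, Term.subst, σ] using
        rule meetR (by simp [commonRules]) (σ a b a x [] []) (by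
          simpa [meetR, MetaSequent.inst, MetaItem.inst, Term.subst, σ] using
            ⟨iha.2 x hx.1, ihb.2 x hx.2⟩)
  | join a b iha ihb =>
    refine ⟨fun Γ Δ β h => ?_, fun x hx => isCl_provable _ _ fun Γ Δ β h => hx Γ Δ β ?_⟩
    · simpa [joinL, MetaSequent.inst, MetaItem.inst, Term.subst, σ] using
        rule joinL (by simp [commonRules]) (σ a b β Γ Δ []) (by
          simpa [joinL, MetaSequent.inst, MetaItem.inst, Term.subst, σ] using
            And.intro (h _ (.inl iha.1)) (h _ (.inr ihb.1)))
    · rintro y (hy | hy) <;> refine h _ ?_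
      · simpa [joinR₀, MetaSequent.inst, MetaItem.inst, Term.subst, σ] using
          rule joinR₀ (by simp [commonRules]) (σ a b a y [] []) (by
            simpa [joinR₀, MetaSequent.inst, MetaItem.inst, Term.subst, σ] using iha.2 y hy)
      · simpa [joinR₁, MetaSequent.inst, MetaItem.inst, Term.subst, σ] using
          rule joinR₁ (by simp [commonRules]) (σ a b a y [] []) (by
            simpa [joinR₁, MetaSequent.inst, MetaItem.inst, Term.subst, σ] using ihb.2 y hy)
  | mul a b iha ihb =>
    refine ⟨fun Γ Δ β h => ?_, fun x hx => isCl_provable _ _ fun Γ Δ β h => hx Γ Δ β ?_⟩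
    · simpa [mulL, MetaSequent.inst, MetaItem.inst, Term.subst, σ] using
        rule mulL (by simp [commonRules]) (σ a b β Γ Δ []) (by
          simpa [mulL, MetaSequent.inst, MetaItem.inst, Term.subst, σ] using
            h _ ⟨_, iha.1, _, ihb.1, rfl⟩)
    · rintro _ ⟨y, hy, z, hz, rfl⟩
      refine h _ ?_
      simpa [mulR, MetaSequent.inst, MetaItem.inst, Term.subst, σ] using
        rule mulR (by simp [commonRules]) (σ a b a y z []) (by
          simpa [mulR, MetaSequent.inst, MetaItem.inst, Term.subst, σ] using
            ⟨iha.2 y hy, ihb.2 z hz⟩)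
  | under a b iha ihb =>
    refine ⟨fun y hy => isCl_val _ _ fun Γ Δ β h => ?_, fun x hx => ?_⟩
    · simpa [underL, MetaSequent.inst, MetaItem.inst, Term.subst, σ] using
        rule underL (by simp [commonRules]) (σ a b β Γ y Δ) (by
          simpa [underL, MetaSequent.inst, MetaItem.inst, Term.subst, σ] using
            And.intro (iha.2 y hy) (h _ ihb.1))
    · simpa [underR, MetaSequent.inst, MetaItem.inst, Term.subst, σ] using
        rule underR (by simp [commonRules]) (σ a b a x [] []) (by
          simpa [underR, MetaSequent.inst, MetaItem.inst, Term.subst, σ] using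
            ihb.2 _ (hx _ iha.1))
  | star a iha =>
    refine ⟨fun Γ Δ β h => omegaSystem_provable_starL fun n => h _ (Set.mem_iUnion.2 ⟨n, ?_⟩),
      fun x hx => isCl_provable _ _ fun Γ Δ β h => hx Γ Δ β fun y hy => h y ?_⟩
    · induction n with
      | zero => rfl
      | succ n ih => exact ⟨_, iha.1, _, ih, rfl⟩
    · obtain ⟨n, hn⟩ := Set.mem_iUnion.1 hy
      clear hy h
      induction n generalizing y with
      | zero =>
        obtain rfl : y = [] := hn
        simpa [starR₀, MetaSequent.inst, MetaItem.inst, Term.subst, σ] using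
          rule starR₀ (by simp [commonRules]) (σ a a a [] [] []) (by simp [starR₀])
      | succ n ih =>
        obtain ⟨u, hu, z, hz, rfl⟩ := hn
        simpa [starR₁, MetaSequent.inst, MetaItem.inst, Term.subst, σ] using
          rule starR₁ (by simp [commonRules]) (σ a a a u z []) (by
            simpa [starR₁, MetaSequent.inst, MetaItem.inst, Term.subst, σ] using
              ⟨iha.2 u hu, ih z hz⟩)
  -- The remaining case is `over b a`; with the names swapped it mirrors `under a b`.
  | _ b a ihb iha =>
    refine ⟨fun y hy => isCl_val _ _ fun Γ Δ β h => ?_, fun x hx => ?_⟩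
    · simpa [overL, MetaSequent.inst, MetaItem.inst, Term.subst, σ] using
        rule overL (by simp [commonRules]) (σ a b β Γ y Δ) (by
          simpa [overL, MetaSequent.inst, MetaItem.inst, Term.subst, σ] using
            And.intro (iha.2 y hy) (h _ ihb.1))
    · simpa [overR, MetaSequent.inst, MetaItem.inst, Term.subst, σ] using
        rule overR (by simp [commonRules]) (σ a b a x [] []) (by
          simpa [overR, MetaSequent.inst, MetaItem.inst, Term.subst, σ] using
            ihb.2 _ (hx _ iha.1))

/-! ### Annotated witnesses -/

/-- `d.1` belongs to the value of the formula; if the formula is `γ^*`, then `d.1` belongs to the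
`d.2`-th power of the value of `γ`. -/
def Good (P : Sequent → Prop) : Formula → List Formula × ℕ → Prop
  | .star γ, d => d.1 ∈ pw (val P γ) d.2
  | α, d => d.1 ∈ val P α

/-- The value of γ^* is the closure of a union of powers, so a closed set may be tested on elements
of a definite power. This is where a star acquires its annotation. -/
theorem Good.of_forall {P : Sequent → Prop} {α : Formula} {C : Set (List Formula)}
    (hC : IsCl P C) {g d x : List Formula} (hx : x ∈ val P α)
    (h : ∀ e, Good P α e → g ++ e.1 ++ d ∈ C) : g ++ x ++ d ∈ C := by
  cases α with
  | star γ =>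
    refine hC.append hx fun y hy => ?_
    obtain ⟨n, hn⟩ := Set.mem_iUnion.1 hy
    exact h (y, n) hn
  | _ => exact h (x, 0) hx

theorem exists_good {R : Set SchematicRule} (α : Formula) :
    ∃ e, Good (omegaSystem R).Provable α e := by
  cases α with
  | star γ => exact ⟨([], 0), rfl⟩
  | _ => exact ⟨([_], 0), (val_spec _).1⟩

theorem exists_forall₂_good {R : Set SchematicRule} (Γ : List Formula) :
    ∃ ds, List.Forall₂ (Good (omegaSystem R).Provable) Γ ds := by
  choose f hf using exists_good (R := R)
  exact ⟨Γ.map f, by simp [List.forall₂_map_right_iff, List.forall₂_same, hf]⟩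

/-- Formulas are replaced from left to right, with p collecting the witnesses found so far. As `[α]
∈ val α`, if every good witness for α led into C, so would α itself. -/
theorem exists_forall₂_good_of_not_mem {R : Set SchematicRule} {C : Set (List Formula)}
    (hC : IsCl (omegaSystem R).Provable C) (Γ p : List Formula) (h : p ++ Γ ∉ C) :
    ∃ ds, List.Forall₂ (Good (omegaSystem R).Provable) Γ ds ∧ p ++ ds.flatMap Prod.fst ∉ C := by
  induction Γ generalizing p with
  | nil => exact ⟨[], .nil, by simpa using h⟩
  | cons α Γ ih =>
    have : ∃ e, Good (omegaSystem R).Provable α e ∧ p ++ e.1 ++ Γ ∉ C := by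
      by_contra hne
      refine h ?_
      simpa using Good.of_forall hC (g := p) (d := Γ) (val_spec (R := R) α).1 fun e he => by
        by_contra hn
        exact hne ⟨e, he, hn⟩
    obtain ⟨e, he, hn⟩ := this
    obtain ⟨ds, hds, hn'⟩ := ih _ hn
    exact ⟨e :: ds, .cons he hds, by simpa using hn'⟩

/-! ### Witnesses indexed by metavariables and origins -/

/-- The annotated witnesses of a schematic item. -/
def MetaItem.wit (τ : ℕ → List (List Formula × ℕ)) (δ : MetaFormula → List Formula × ℕ) :
    MetaItem → List (List Formula × ℕ)
  | .seq X => τ X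
  | .fml φ _ => [δ φ]

/-- The metavariable or metaformula of an item. -/
def MetaItem.key : MetaItem → ℕ ⊕ MetaFormula
  | .seq X => .inl X
  | .fml φ _ => .inr φ

theorem MetaItem.flatMap_wit_congr {ms : List MetaItem} {τ τ' : ℕ → List (List Formula × ℕ)}
    {δ δ' : MetaFormula → List Formula × ℕ} (hτ : ∀ X, .inl X ∈ ms.map MetaItem.key → τ X = τ' X)
    (hδ : ∀ φ, .inr φ ∈ ms.map MetaItem.key → δ φ = δ' φ) :
    ms.flatMap (MetaItem.wit τ δ) = ms.flatMap (MetaItem.wit τ' δ') := by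
  refine List.flatMap_congr fun m hm => ?_
  cases m with
  | seq X => exact hτ X (List.mem_map.2 ⟨_, hm, rfl⟩)
  | fml φ b => simp [MetaItem.wit, hδ φ (List.mem_map.2 ⟨_, hm, rfl⟩)]

theorem exists_append_of_forall₂ {A B : Type} {r : A → B → Prop} {l₁ l₂ : List A} {ds : List B}
    (h : List.Forall₂ r (l₁ ++ l₂) ds) :
    ∃ d₁ d₂, List.Forall₂ r l₁ d₁ ∧ List.Forall₂ r l₂ d₂ ∧ ds = d₁ ++ d₂ :=
  ⟨_, _, by simpa using List.forall₂_take l₁.length h, by simpa using List.forall₂_drop l₁.length h,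
    (List.take_append_drop _ _).symm⟩

open Classical in
-- A flat list of witnesses is cut into one block per schematic item. Distinct keys prevent two
-- blocks from competing for the same metavariable or metaformula; absent keys receive arbitrary
-- good witnesses.
theorem MetaItem.exists_wit {R : Set SchematicRule} (σ : Instantiation) (ms : List MetaItem)
    (hms : (ms.map MetaItem.key).Nodup) (ds : List (List Formula × ℕ))
    (h : List.Forall₂ (Good (omegaSystem R).Provable) (ms.flatMap (MetaItem.inst σ)) ds) :
    ∃ τ δ, ds = ms.flatMap (MetaItem.wit τ δ) ∧
      (∀ X, List.Forall₂ (Good (omegaSystem R).Provable) (σ.seq X) (τ X)) ∧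
      ∀ φ : MetaFormula, Good (omegaSystem R).Provable (φ.subst σ.fml) (δ φ) := by
  induction ms generalizing ds with
  | nil =>
    choose τ hτ using fun X => exists_forall₂_good (R := R) (σ.seq X)
    choose δ hδ using fun φ : MetaFormula => exists_good (R := R) (φ.subst σ.fml)
    exact ⟨τ, δ, by simpa using h, hτ, hδ⟩
  | cons m ms ih =>
    rw [List.map_cons, List.nodup_cons] at hms
    rw [List.flatMap_cons] at h
    obtain ⟨d₁, d₂, h₁, h₂, rfl⟩ := exists_append_of_forall₂ h
    obtain ⟨τ, δ, rfl, hτ, hδ⟩ := ih hms.2 _ h₂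
    cases m with
    | seq Y =>
      refine ⟨Function.update τ Y d₁, δ, ?_, fun X => ?_, hδ⟩
      · rw [List.flatMap_cons]
        congr 1
        · simp [MetaItem.wit]
        · refine MetaItem.flatMap_wit_congr (fun X hX => ?_) fun _ _ => rfl
          rw [Function.update_of_ne]
          rintro rfl
          exact hms.1 hX
      · by_cases hX : X = Y
        · subst hX
          simpa [MetaItem.inst] using h₁
        · simpa [hX] using hτ X
    | fml ψ b =>
      obtain ⟨e, he⟩ : ∃ e, d₁ = [e] := by
        have := h₁.length_eq
        exact List.length_eq_one_iff.1 (by simpa [MetaItem.inst] using this.symm)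
      subst he
      refine ⟨τ, Function.update δ ψ e, ?_, hτ, fun φ => ?_⟩
      · rw [List.flatMap_cons]
        congr 1
        · simp [MetaItem.wit]
        · refine MetaItem.flatMap_wit_congr (fun _ _ => rfl) fun φ hφ => ?_
          rw [Function.update_of_ne]
          rintro rfl
          exact hms.1 hφ
      · by_cases hφ : φ = ψ
        · subst hφ
          simpa [MetaItem.inst] using h₁
        · simpa [hφ] using hδ φ

theorem map_some_flatMap_eq {A : Type} {σ : Instantiation} {f : MetaItem → List A}
    {v : Origin → Option A} (hseq : ∀ X, (f (.seq X)).length = (σ.seq X).length)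
    (hv : ∀ X k, v (.seq X k) = (f (.seq X))[k]?)
    (hfml : ∀ φ b, (f (.fml φ b)).map some = [v (.fml φ b)]) (ms : List MetaItem) :
    (ms.flatMap f).map some = (ms.flatMap (MetaItem.origins σ)).map v := by
  rw [List.map_flatMap, List.map_flatMap]
  refine List.flatMap_congr fun m _ => ?_
  cases m with
  | seq X =>
    refine List.ext_getElem? fun k => ?_
    simp only [MetaItem.origins, List.getElem?_map, ← hseq]
    by_cases hk : k < (f (.seq X)).length
    · simp [hk, hv]
    · simp [hk]
  | fml φ b => simp [hfml, MetaItem.origins]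

/-- What stands at a position depends only on its origin. Used for witnesses and for formulas, this
turns the ancestor relation on positions into one on origins. -/
theorem getElem?_eq_of_origin {A : Type} {σ : Instantiation} {f : MetaItem → List A}
    {v : Origin → Option A} (hseq : ∀ X, (f (.seq X)).length = (σ.seq X).length)
    (hv : ∀ X k, v (.seq X k) = (f (.seq X))[k]?)
    (hfml : ∀ φ b, (f (.fml φ b)).map some = [v (.fml φ b)]) {ms : List MetaItem} {j : ℕ}
    {o : Origin} (ho : (ms.flatMap (MetaItem.origins σ))[j]? = some o) :
    (ms.flatMap f)[j]? = v o := by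
  have h := congrArg (·[j]?) (map_some_flatMap_eq hseq hv hfml ms)
  simp only [List.getElem?_map, ho, Option.map_some] at h
  obtain ⟨a, ha, ha'⟩ := Option.map_eq_some_iff.1 h
  rw [ha, ha']

/-- The annotated witness at an origin. -/
def Origin.wit (τ : ℕ → List (List Formula × ℕ)) (δ : MetaFormula → List Formula × ℕ) :
    Origin → Option (List Formula × ℕ)
  | .seq X k => (τ X)[k]?
  | .fml φ _ => some (δ φ)

/-- The formula at an origin. -/
def Origin.formula (σ : Instantiation) : Origin → Option Formula
  | .seq X k => (σ.seq X)[k]?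
  | .fml φ _ => some (φ.subst σ.fml)

theorem fml_mem_of_origin {σ : Instantiation} {ms : List MetaItem} {j : ℕ} {φ : MetaFormula}
    {b : Bool} (ho : (ms.flatMap (MetaItem.origins σ))[j]? = some (.fml φ b)) :
    .fml φ b ∈ ms := by
  obtain ⟨m, hm, hmo⟩ := List.mem_flatMap.1 (List.mem_of_getElem? ho)
  cases m with
  | seq X => simp [MetaItem.origins] at hmo
  | fml ψ c =>
    simp only [MetaItem.origins, List.mem_singleton, Origin.fml.injEq] at hmo
    rwa [hmo.1, hmo.2]

/-! ### Soundness of rule instances -/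

/-- If the conclusion of `s` fails under the annotated witnesses `ds`, then some premise fails
under annotated witnesses such that the annotations do not increase along threads on a formula
`α^*`, and decrease where it is principal. -/
def StepSound (P : Sequent → Prop) (s : Inference) : Prop :=
  ∀ ds, List.Forall₂ (Good P) s.concl.ant ds → ds.flatMap Prod.fst ∉ val P s.concl.suc →
    ∃ i S ds', s.prem i = some S ∧ List.Forall₂ (Good P) S.ant ds' ∧
      ds'.flatMap Prod.fst ∉ val P S.suc ∧
      ∀ j j' α d d', s.anc i (.left j) (.left j') → s.concl.at (.left j) = some (.star α) →
        S.at (.left j') = some (.star α) → ds[j]? = some d → ds'[j']? = some d' →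
        d'.2 ≤ d.2 ∧ (s.principal (.left j) → d'.2 < d.2)

/-- The schematic form of soundness, for fixed witnesses of the sequence metavariables. -/
def SchematicRule.SoundAt (P : Sequent → Prop) (r : SchematicRule) (σ : Instantiation) : Prop :=
  ∀ (τ : ℕ → List (List Formula × ℕ)) (δ : MetaFormula → List Formula × ℕ),
    (∀ φ : MetaFormula, Good P (φ.subst σ.fml) (δ φ)) →
    (∀ S ∈ r.prems, ∀ δ' : MetaFormula → List Formula × ℕ,
      (∀ φ b, .fml φ b ∈ S.ant → Good P (φ.subst σ.fml) (δ' φ)) →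
      (∀ φ φ' α, .fml φ true ∈ r.concl.ant → .fml φ' true ∈ S.ant →
        φ.subst σ.fml = .star α → φ'.subst σ.fml = .star α → (δ' φ').2 < (δ φ).2) →
      (S.ant.flatMap (MetaItem.wit τ δ')).flatMap Prod.fst ∈ val P (S.suc.subst σ.fml)) →
    (r.concl.ant.flatMap (MetaItem.wit τ δ)).flatMap Prod.fst ∈
      val P (r.concl.suc.subst σ.fml)

/-- Occurrences inside sequence metavariables keep their witness and are never principal. Boxed
pairs on the same star decrease by the hypothesis in `SoundAt`, and formula metavariables do not
occur on the left of the conclusion. -/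
theorem SchematicRule.SoundAt.stepSound {R : Set SchematicRule} {r : SchematicRule}
    {σ : Instantiation} (h : r.SoundAt (omegaSystem R).Provable σ)
    (hnd : (r.concl.ant.map MetaItem.key).Nodup)
    (hvar : ∀ x b, .fml (.var x) b ∉ r.concl.ant) :
    StepSound (omegaSystem R).Provable (schemaInst (fun i => r.prems[i]?) r.concl σ) := by
  intro ds hds hfail
  obtain ⟨τ, δ, rfl, hτ, hδ⟩ := MetaItem.exists_wit σ r.concl.ant hnd ds hds
  by_contra hne
  refine hfail (h τ δ hδ fun S hS δ' hδ' hdec => ?_)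
  by_contra hn
  obtain ⟨i, hi⟩ := List.mem_iff_getElem?.1 hS
  refine hne ⟨i, S.inst σ, S.ant.flatMap (MetaItem.wit τ δ'), by simp [schemaInst, hi], ?_, hn,
    fun j j' α d d' hanc hα hα' hd hd' => ?_⟩
  · refine List.rel_flatMap (R := fun a b => a = b ∧ a ∈ S.ant) (List.forall₂_same.2
      fun m hm => ⟨rfl, hm⟩) ?_
    rintro m _ ⟨rfl, hm⟩
    cases m with
    | seq X => exact hτ X
    | fml φ b => exact .cons (hδ' φ b hm) .nil
  · have hlen : ∀ X, (τ X).length = (σ.seq X).length := fun X => (hτ X).length_eq.symm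
    obtain ⟨S', hS', o, o', ho, ho', hoo⟩ := hanc
    obtain rfl : S = S' := Option.some.inj (hi.symm.trans hS')
    have hw : _ = Origin.wit τ δ o := getElem?_eq_of_origin (f := MetaItem.wit τ δ) hlen (fun _ _ => rfl)
      (fun _ _ => rfl) ho
    have hw' : _ = Origin.wit τ δ' o' := getElem?_eq_of_origin (f := MetaItem.wit τ δ') hlen (fun _ _ => rfl)
      (fun _ _ => rfl) ho'
    have hf : _ = Origin.formula σ o := getElem?_eq_of_origin (f := MetaItem.inst σ)
      (fun _ => rfl) (fun _ _ => rfl)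
      (fun _ _ => rfl) ho
    have hf' : _ = Origin.formula σ o' := getElem?_eq_of_origin (f := MetaItem.inst σ)
      (fun _ => rfl) (fun _ _ => rfl)
      (fun _ _ => rfl) ho'
    rw [hd] at hw
    rw [hd'] at hw'
    replace hf := hf.symm.trans hα
    replace hf' := hf'.symm.trans hα'
    cases hoo with
    | boxed φ φ' =>
      obtain rfl := Option.some.inj hw
      obtain rfl := Option.some.inj hw'
      have := hdec _ _ α (fml_mem_of_origin ho) (fml_mem_of_origin ho') (Option.some.inj hf)
        (Option.some.inj hf')
      exact ⟨this.le, fun _ => this⟩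
    | fmlVar x b b' => exact absurd (fml_mem_of_origin ho) (hvar x _)
    | seqVar X k =>
      obtain rfl : d = d' := Option.some.inj (hw.trans hw'.symm)
      refine ⟨le_rfl, ?_⟩
      rintro ⟨φ, hφ⟩
      have := ho.symm.trans hφ
      simp at this

/-! ### Soundness of the logical rules and cut -/

theorem SchematicRule.soundAt_zeroL {P : Sequent → Prop} (σ : Instantiation) :
    zeroL.SoundAt P σ := by
  intro τ δ hδ _
  have h0 : (δ .zero).1 ∈ cl P ∅ := hδ .zero
  simpa [zeroL, MetaItem.wit, Term.subst] using (isCl_val P (σ.fml 2)).append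
    (g := (τ 0).flatMap Prod.fst) (d := (τ 1).flatMap Prod.fst) h0 (by simp)

theorem SchematicRule.soundAt_oneL {P : Sequent → Prop} (σ : Instantiation) :
    oneL.SoundAt P σ := by
  intro τ δ hδ h
  have h0 : (δ .one).1 ∈ cl P {[]} := hδ .one
  simpa [oneL, MetaItem.wit, Term.subst] using (isCl_val P (σ.fml 2)).append
    (g := (τ 0).flatMap Prod.fst) (d := (τ 1).flatMap Prod.fst) h0 (by
      rintro _ rfl
      simpa [MetaItem.wit, Term.subst] using h _ (List.mem_singleton.2 rfl) δ (by simp) (by simp))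

theorem SchematicRule.soundAt_oneR {P : Sequent → Prop} (σ : Instantiation) :
    oneR.SoundAt P σ := by
  intro τ δ _ _
  exact subset_cl P _ rfl

theorem SchematicRule.soundAt_meetL₀ {P : Sequent → Prop} (σ : Instantiation) :
    meetL₀.SoundAt P σ := by
  intro τ δ hδ h
  have h0 := hδ (.meet (.var 0) (.var 1))
  simpa [meetL₀, MetaItem.wit, Term.subst] using Good.of_forall (isCl_val P (σ.fml 2))
    (g := (τ 0).flatMap Prod.fst) (d := (τ 1).flatMap Prod.fst) h0.1 fun e he => by
      simpa [MetaItem.wit, Term.subst] using h _ (List.mem_singleton.2 rfl) (fun _ => e)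
        (by simpa using he) (by simp +contextual [meetL₀, Term.subst])

theorem SchematicRule.soundAt_meetL₁ {P : Sequent → Prop} (σ : Instantiation) :
    meetL₁.SoundAt P σ := by
  intro τ δ hδ h
  have h0 := hδ (.meet (.var 0) (.var 1))
  simpa [meetL₁, MetaItem.wit, Term.subst] using Good.of_forall (isCl_val P (σ.fml 2))
    (g := (τ 0).flatMap Prod.fst) (d := (τ 1).flatMap Prod.fst) h0.2 fun e he => by
      simpa [MetaItem.wit, Term.subst] using h _ (List.mem_singleton.2 rfl) (fun _ => e)
        (by simpa using he) (by simp +contextual [meetL₁, Term.subst])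

theorem SchematicRule.soundAt_meetR {P : Sequent → Prop} (σ : Instantiation) :
    meetR.SoundAt P σ := by
  intro τ δ hδ h
  exact ⟨h ⟨[.seq 0], .var 0, true⟩ (by simp [meetR]) δ (by simp) (by simp),
    h ⟨[.seq 0], .var 1, true⟩ (by simp [meetR]) δ (by simp) (by simp)⟩

theorem SchematicRule.soundAt_joinL {P : Sequent → Prop} (σ : Instantiation) :
    joinL.SoundAt P σ := by
  intro τ δ hδ h
  have h0 := hδ (.join (.var 0) (.var 1))
  simpa [joinL, MetaItem.wit, Term.subst] using (isCl_val P (σ.fml 2)).append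
    (g := (τ 0).flatMap Prod.fst) (d := (τ 1).flatMap Prod.fst) h0 (by
      rintro y (hy | hy) <;> refine Good.of_forall (isCl_val P (σ.fml 2)) hy fun e he => ?_
      · simpa [MetaItem.wit, Term.subst] using h _ (List.mem_cons_self ..) (fun _ => e)
          (by simpa using he) (by simp +contextual [joinL, Term.subst])
      · simpa [MetaItem.wit, Term.subst] using h _ (List.mem_cons_of_mem _ (List.mem_cons_self ..))
          (fun _ => e) (by simpa using he) (by simp +contextual [joinL, Term.subst]))

theorem SchematicRule.soundAt_joinR₀ {P : Sequent → Prop} (σ : Instantiation) :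
    joinR₀.SoundAt P σ := by
  intro τ δ hδ h
  exact subset_cl P _ (.inl (h _ (List.mem_singleton.2 rfl) δ (by simp) (by simp)))

theorem SchematicRule.soundAt_joinR₁ {P : Sequent → Prop} (σ : Instantiation) :
    joinR₁.SoundAt P σ := by
  intro τ δ hδ h
  exact subset_cl P _ (.inr (h _ (List.mem_singleton.2 rfl) δ (by simp) (by simp)))

theorem SchematicRule.soundAt_mulL {P : Sequent → Prop} (σ : Instantiation) :
    mulL.SoundAt P σ := by
  intro τ δ hδ h
  have h0 := hδ (.mul (.var 0) (.var 1))
  have hC := isCl_val P (σ.fml 2)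
  simpa [mulL, MetaItem.wit, Term.subst] using hC.append
    (g := (τ 0).flatMap Prod.fst) (d := (τ 1).flatMap Prod.fst) h0 (by
      rintro _ ⟨x, hx, y, hy, rfl⟩
      -- The factors are replaced by annotated witnesses one after the other, since either may
      -- itself be a star.
      have key := Good.of_forall hC (g := (τ 0).flatMap Prod.fst)
        (d := y ++ (τ 1).flatMap Prod.fst) hx fun e he => by
          have := Good.of_forall hC (g := (τ 0).flatMap Prod.fst ++ e.1)
            (d := (τ 1).flatMap Prod.fst) hy fun e' he' => by
              simpa [MetaItem.wit, Term.subst] using h _ (List.mem_singleton.2 rfl)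
                (fun | .var 0 => e | _ => e') (by
                  rintro φ b hφ
                  simp only [List.mem_cons, reduceCtorEq, MetaItem.fml.injEq, false_or,
                    List.not_mem_nil, or_false] at hφ
                  rcases hφ with ⟨rfl, rfl⟩ | ⟨rfl, rfl⟩
                  · exact he
                  · exact he') (by simp +contextual [mulL, Term.subst])
          simpa using this
      simpa using key)

theorem SchematicRule.soundAt_mulR {P : Sequent → Prop} (σ : Instantiation) :
    mulR.SoundAt P σ := by
  intro τ δ hδ h
  refine subset_cl P _ ⟨_, h ⟨[.seq 0], .var 0, true⟩ (by simp [mulR]) δ (by simp) (by simp), _,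
    h ⟨[.seq 1], .var 1, true⟩ (by simp [mulR]) δ (by simp) (by simp), ?_⟩
  simp [mulR, MetaItem.wit]

theorem SchematicRule.soundAt_underL {P : Sequent → Prop} (σ : Instantiation) :
    underL.SoundAt P σ := by
  intro τ δ hδ h
  have h0 := hδ (.under (.var 0) (.var 1)) _
    (h _ (List.mem_cons_self ..) δ (by simp) (by simp))
  simpa [underL, MetaItem.wit, Term.subst] using Good.of_forall (isCl_val P (σ.fml 2))
    (g := (τ 0).flatMap Prod.fst) (d := (τ 2).flatMap Prod.fst) h0 fun e he => by
      simpa [MetaItem.wit, Term.subst] using h _ (List.mem_cons_of_mem _ (List.mem_cons_self ..))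
        (fun _ => e) (by simpa using he) (by simp +contextual [underL, Term.subst])

theorem SchematicRule.soundAt_overL {P : Sequent → Prop} (σ : Instantiation) :
    overL.SoundAt P σ := by
  intro τ δ hδ h
  have h0 := hδ (.over (.var 1) (.var 0)) _
    (h _ (List.mem_cons_self ..) δ (by simp) (by simp))
  simpa [overL, MetaItem.wit, Term.subst] using Good.of_forall (isCl_val P (σ.fml 2))
    (g := (τ 0).flatMap Prod.fst) (d := (τ 2).flatMap Prod.fst) h0 fun e he => by
      simpa [MetaItem.wit, Term.subst] using h _ (List.mem_cons_of_mem _ (List.mem_cons_self ..))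
        (fun _ => e) (by simpa using he) (by simp +contextual [overL, Term.subst])

theorem SchematicRule.soundAt_underR {P : Sequent → Prop} (σ : Instantiation) :
    underR.SoundAt P σ := by
  intro τ δ hδ h y hy
  simpa [underR, MetaItem.wit, Term.subst] using Good.of_forall (isCl_val P (σ.fml 1)) (g := []) (d := (τ 0).flatMap Prod.fst) hy
    fun e he => by
      simpa [MetaItem.wit, Term.subst] using h _ (List.mem_singleton.2 rfl) (fun _ => e)
        (by simpa using he) (by simp [underR])

theorem SchematicRule.soundAt_overR {P : Sequent → Prop} (σ : Instantiation) :
    overR.SoundAt P σ := by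
  intro τ δ hδ h y hy
  simpa [overR, MetaItem.wit, Term.subst] using Good.of_forall (isCl_val P (σ.fml 1))
    (g := (τ 0).flatMap Prod.fst) (d := []) hy fun e he => by
      simpa [MetaItem.wit, Term.subst] using h _ (List.mem_singleton.2 rfl) (fun _ => e)
        (by simpa using he) (by simp [overR])

theorem SchematicRule.soundAt_starR₀ {P : Sequent → Prop} (σ : Instantiation) :
    starR₀.SoundAt P σ := by
  intro τ δ hδ h
  exact subset_cl P _ (Set.mem_iUnion.2 ⟨0, rfl⟩)

theorem SchematicRule.soundAt_starR₁ {P : Sequent → Prop} (σ : Instantiation) :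
    starR₁.SoundAt P σ := by
  intro τ δ hδ h
  have h0 := h ⟨[.seq 0], .var 0, true⟩ (by simp [starR₁]) δ (by simp) (by simp)
  have h1 := h ⟨[.seq 1], .star (.var 0), true⟩ (by simp [starR₁]) δ (by simp) (by simp)
  have key := (isCl_val P (.star (σ.fml 0))).append (d := []) h1 fun y hy => by
    obtain ⟨n, hn⟩ := Set.mem_iUnion.1 hy
    exact subset_cl P _ (Set.mem_iUnion.2 ⟨n + 1, _, h0, y, hn, List.append_nil _⟩)
  simpa [starR₁, MetaItem.wit, Term.subst] using key

/-- A witness in the zeroth power is empty and leads to the left premise. One in the power n + 1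
splits into an element of the value of α and a witness for α^* annotated n, and leads to the right
premise. -/
theorem SchematicRule.soundAt_starL {P : Sequent → Prop} (σ : Instantiation) :
    starL.SoundAt P σ := by
  intro τ δ hδ h
  have h0 := hδ (.star (.var 0))
  have hC := isCl_val P (σ.fml 2)
  obtain ⟨x, n, hxn⟩ : ∃ x n, δ (.star (.var 0)) = (x, n) := ⟨_, _, rfl⟩
  rw [hxn] at h0
  suffices hx : (τ 0).flatMap Prod.fst ++ x ++ (τ 1).flatMap Prod.fst ∈ val P (σ.fml 2) by
    simpa [starL, MetaItem.wit, Term.subst, hxn] using hx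
  cases n with
  | zero =>
    obtain rfl : x = [] := h0
    simpa [MetaItem.wit, Term.subst] using h _ (List.mem_cons_self ..) δ (by simp) (by simp)
  | succ n =>
    obtain ⟨y, hy, z, hz, rfl⟩ := h0
    have key := Good.of_forall hC (g := (τ 0).flatMap Prod.fst)
      (d := z ++ (τ 1).flatMap Prod.fst) hy fun e he => by
        simpa [MetaItem.wit, Term.subst] using h _ (List.mem_cons_of_mem _ (List.mem_cons_self ..))
          (fun | .var 0 => e | _ => (z, n)) (by
            rintro φ b hφ
            simp only [List.mem_cons, reduceCtorEq, MetaItem.fml.injEq, false_or,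
              List.not_mem_nil, or_false] at hφ
            rcases hφ with ⟨rfl, rfl⟩ | ⟨rfl, rfl⟩
            · exact he
            · exact hz) (by
            rintro φ φ' α hφ hφ' hα hα'
            simp only [starL, List.mem_cons, reduceCtorEq, MetaItem.fml.injEq, false_or,
              List.not_mem_nil, or_false, and_true] at hφ hφ'
            subst hφ
            rcases hφ' with rfl | rfl
            -- The auxiliary α cannot coincide with α^*, by size, so only the auxiliary star has to
            -- decrease.
            · have h1 : σ.fml 0 = α := Term.star.inj hα
              have h2 : σ.fml 0 = .star α := hα'
              have := congrArg sizeOf (h1.symm.trans h2)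
              simp at this
            · simp [hxn])
    simpa using key

/-- The left premise puts the witness of Δ into the value of the cut formula, where the right
premise uses it. The cut formula has no counterpart in the conclusion, so its annotation is
unconstrained. -/
theorem SchematicRule.soundAt_cut {P : Sequent → Prop} (σ : Instantiation) :
    cut.SoundAt P σ := by
  intro τ δ hδ h
  have h0 := h _ (List.mem_cons_self ..) δ (by simp) (by simp)
  simpa [cut, MetaItem.wit, Term.subst] using Good.of_forall (isCl_val P (σ.fml 2))
    (g := (τ 0).flatMap Prod.fst) (d := (τ 2).flatMap Prod.fst) h0 fun e he => by
      simpa [MetaItem.wit, Term.subst] using h _ (List.mem_cons_of_mem _ (List.mem_cons_self ..))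
        (fun _ => e) (by simpa using he) (by simp)

/-! ### Soundness of analytic rules -/

theorem flatMap_wit_map_seq (τ : ℕ → List (List Formula × ℕ))
    (δ : MetaFormula → List Formula × ℕ) (V : List ℕ) :
    ((V.map MetaItem.seq).flatMap (MetaItem.wit τ δ)).flatMap Prod.fst =
      V.flatMap fun X => (τ X).flatMap Prod.fst := by
  rw [List.flatMap_map, List.flatMap_assoc]
  rfl

theorem flatMap_inst_map_seq (σ : Instantiation) (V : List ℕ) :
    (V.map MetaItem.seq).flatMap (MetaItem.inst σ) = V.flatMap σ.seq := by
  rw [List.flatMap_map]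
  rfl

theorem SchematicRule.IsAnalytic.nodup {r : SchematicRule} (hr : r.IsAnalytic) :
    (r.concl.ant.map MetaItem.key).Nodup := by
  obtain ⟨Xs, hXs, h⟩ := hr.1.2
  rw [h, List.map_map]
  exact hXs.map fun X Y h => Sum.inl.inj h

/-- Since the value of β is closed, it suffices to prove sequents in contexts Γ', Δ' and with
right-hand side β'. The rule itself, as a rule of the cut-free system, proves them. -/
theorem SchematicRule.IsAnalytic.soundAt {R : Set SchematicRule} {r : SchematicRule}
    (hr : r.IsAnalytic) (hrR : r ∈ R) (σ : Instantiation) :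
    r.SoundAt (omegaSystem R).Provable σ := by
  intro τ δ hδ h
  obtain ⟨⟨-, Xs, hXs, hX⟩, Γ, Δ, β, U, Us, hU, hp, hc⟩ := hr
  have hXU : Xs = [Γ] ++ U ++ [Δ] := by
    rw [hc] at hX
    exact (List.map_injective_iff.2 (fun _ _ h => MetaItem.seq.inj h) hX).symm
  have hΔ : Δ ≠ Γ := by
    rintro rfl
    simp [hXU] at hXs
  have hUne : ∀ X ∈ U, X ≠ Γ ∧ X ≠ Δ := fun X hXU' => by
    rw [hXU] at hXs
    constructor <;> rintro rfl <;> simp [List.nodup_append, hXU'] at hXs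
    exact hXs.2.2 X hXU' rfl
  rw [hc]
  refine isCl_val _ (σ.fml β) fun Γ' Δ' β' hctx => ?_
  let f : ℕ → List Formula := fun X => (τ X).flatMap Prod.fst
  -- Γ absorbs the prefix Γ', Δ absorbs the suffix Δ', and β becomes β'. Distinctness of the
  -- metavariables keeps those in U unaffected.
  let σ' : Instantiation := ⟨fun _ => β',
    fun X => if X = Γ then Γ' ++ f Γ else if X = Δ then f Δ ++ Δ' else f X⟩
  have hV : ∀ V : List ℕ, (∀ X ∈ V, X ∈ U) →
      MetaSequent.inst σ' ⟨([Γ] ++ V ++ [Δ]).map MetaItem.seq, .var β, false⟩ =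
        ⟨Γ' ++ ([Γ] ++ V ++ [Δ]).flatMap f ++ Δ', β'⟩ := fun V hVU => by
    have hflat : V.flatMap σ'.seq = V.flatMap f := List.flatMap_congr fun X hXV => by
      have := hUne X (hVU X hXV)
      simp [σ', this]
    simp only [MetaSequent.inst, flatMap_inst_map_seq, List.flatMap_append, hflat]
    simp [σ', hΔ, Term.subst]
  have key := omegaSystem_provable_schema (R := R) (r := r) (.inr hrR) σ' fun S hS => by
    rw [hp] at hS
    obtain ⟨V, hVU, rfl⟩ := List.mem_map.1 hS
    rw [hV V (hU V hVU)]
    have := h _ (hp ▸ hS) δ (by simp) (by simp)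
    rw [flatMap_wit_map_seq] at this
    exact hctx _ this
  rw [hc, hV U fun _ h => h] at key
  rw [flatMap_wit_map_seq]
  exact key

theorem stepSound_of_mem_rules {R : Set SchematicRule} (hR : ∀ r ∈ R, r.IsAnalytic)
    {ρ : Set Inference} (hρ : ρ ∈ (nwfSystem (R ∪ {cut})).rules) {s : Inference} (hs : s ∈ ρ) :
    StepSound (omegaSystem R).Provable s := by
  rcases hρ with ((rfl | rfl) | ⟨r, hr, rfl⟩) | ⟨r, hr | rfl, rfl⟩
  · obtain ⟨a, rfl⟩ := hs
    intro ds hds hfail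
    obtain ⟨d, ds, hd, hnil, rfl⟩ := List.forall₂_cons_left_iff.1 hds
    obtain rfl := List.forall₂_nil_left_iff.1 hnil
    have hd' : d.1 ∈ val (omegaSystem R).Provable (.var a) := hd
    exact absurd (by simpa using hd') hfail
  · obtain ⟨σ, rfl⟩ := hs
    exact (SchematicRule.soundAt_starL σ).stepSound (by simp [starL, MetaItem.key])
      (by simp [starL])
  · obtain ⟨σ, rfl⟩ := hs
    simp only [commonRules, Set.mem_insert_iff, Set.mem_singleton_iff] at hr
    rcases hr with rfl | rfl | rfl | rfl | rfl | rfl | rfl | rfl | rfl | rfl | rfl | rfl | rfl |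
      rfl | rfl | rfl | rfl
    · exact (SchematicRule.soundAt_zeroL σ).stepSound (by simp [zeroL, MetaItem.key])
        (by simp [zeroL])
    · exact (SchematicRule.soundAt_oneL σ).stepSound (by simp [oneL, MetaItem.key])
        (by simp [oneL])
    · exact (SchematicRule.soundAt_oneR σ).stepSound (by simp [oneR]) (by simp [oneR])
    · exact (SchematicRule.soundAt_meetL₀ σ).stepSound (by simp [meetL₀, MetaItem.key])
        (by simp [meetL₀])
    · exact (SchematicRule.soundAt_meetL₁ σ).stepSound (by simp [meetL₁, MetaItem.key])
        (by simp [meetL₁])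
    · exact (SchematicRule.soundAt_meetR σ).stepSound (by simp [meetR]) (by simp [meetR])
    · exact (SchematicRule.soundAt_joinL σ).stepSound (by simp [joinL, MetaItem.key])
        (by simp [joinL])
    · exact (SchematicRule.soundAt_joinR₀ σ).stepSound (by simp [joinR₀]) (by simp [joinR₀])
    · exact (SchematicRule.soundAt_joinR₁ σ).stepSound (by simp [joinR₁]) (by simp [joinR₁])
    · exact (SchematicRule.soundAt_mulL σ).stepSound (by simp [mulL, MetaItem.key])
        (by simp [mulL])
    · exact (SchematicRule.soundAt_mulR σ).stepSound (by simp [mulR, MetaItem.key])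
        (by simp [mulR])
    · exact (SchematicRule.soundAt_underL σ).stepSound (by simp [underL, MetaItem.key])
        (by simp [underL])
    · exact (SchematicRule.soundAt_overL σ).stepSound (by simp [overL, MetaItem.key])
        (by simp [overL])
    · exact (SchematicRule.soundAt_underR σ).stepSound (by simp [underR]) (by simp [underR])
    · exact (SchematicRule.soundAt_overR σ).stepSound (by simp [overR]) (by simp [overR])
    · exact (SchematicRule.soundAt_starR₀ σ).stepSound (by simp [starR₀]) (by simp [starR₀])
    · exact (SchematicRule.soundAt_starR₁ σ).stepSound (by simp [starR₁, MetaItem.key])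
        (by simp [starR₁])
  · obtain ⟨σ, rfl⟩ := hs
    refine ((hR r hr).soundAt hr σ).stepSound (hR r hr).nodup ?_
    obtain ⟨Xs, -, hX⟩ := (hR r hr).1.2
    simp [hX]
  · obtain ⟨σ, rfl⟩ := hs
    exact (SchematicRule.soundAt_cut σ).stepSound (by simp [cut, MetaItem.key]) (by simp [cut])

/-! ### Soundness of non-wellfounded proofs -/

/-- A node of a preproof with a failing inference. -/
structure FailingNode (P : Sequent → Prop) (π : Preproof) : Type where
  node : List ℕ
  inf : Inference
  wit : List (List Formula × ℕ)
  label_eq : π.label node = some inf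
  good : List.Forall₂ (Good P) inf.concl.ant wit
  fails : wit.flatMap Prod.fst ∉ val P inf.concl.suc

/-- `StepSound` is iterated: the failing premise it yields labels a child, where the choice is
repeated. -/
theorem exists_failing_branch {P : Sequent → Prop} {π : Preproof}
    (hπ : ∀ w s, π.label w = some s → StepSound P s) (x₀ : FailingNode P π) :
    ∃ x : ℕ → FailingNode P π, x 0 = x₀ ∧ ∀ i, ∃ n, (x (i + 1)).node = (x i).node ++ [n] ∧
      ∀ j j' α d d', (x i).inf.anc n (.left j) (.left j') →
        (x i).inf.concl.at (.left j) = some (.star α) →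
        (x (i + 1)).inf.concl.at (.left j') = some (.star α) →
        (x i).wit[j]? = some d → (x (i + 1)).wit[j']? = some d' →
        d'.2 ≤ d.2 ∧ ((x i).inf.principal (.left j) → d'.2 < d.2) := by
  refine exists_seq_of_forall_exists x₀ (r := fun x y => ∃ n, y.node = x.node ++ [n] ∧
      ∀ j j' α d d', x.inf.anc n (.left j) (.left j') →
        x.inf.concl.at (.left j) = some (.star α) →
        y.inf.concl.at (.left j') = some (.star α) →
        x.wit[j]? = some d → y.wit[j']? = some d' →
        d'.2 ≤ d.2 ∧ (x.inf.principal (.left j) → d'.2 < d.2)) fun x => ?_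
  obtain ⟨i, S, ds', hS, hgood, hfail, hanc⟩ := hπ _ _ x.label_eq x.wit x.good x.fails
  have hstep := π.step x.node i
  rw [x.label_eq, Option.bind_some, hS] at hstep
  obtain ⟨s, hs, rfl⟩ := Option.map_eq_some_iff.1 hstep
  exact ⟨⟨x.node ++ [i], s, ds', hs, hgood, hfail⟩, i, rfl, hanc⟩

/-- A sequence of natural numbers that does not increase on an infinite interval decreases only
finitely often. -/
theorem false_of_infinite_descent {I J : Set ℕ} (hI : I.OrdConnected) (hJI : J ⊆ I)
    (hJ : J.Infinite) (f : ℕ → ℕ) (hle : ∀ i ∈ I, i + 1 ∈ I → f (i + 1) ≤ f i)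
    (hlt : ∀ i ∈ J, i + 1 ∈ I → f (i + 1) < f i) : False := by
  have hmem : ∀ i ∈ I, ∀ j, i ≤ j → j ∈ I := fun i hi j hij => by
    obtain ⟨k, hk, hjk⟩ := hJ.exists_gt j
    exact hI.out hi (hJI hk) ⟨hij, hjk.le⟩
  have hanti : ∀ i ∈ I, ∀ k, f (i + k) ≤ f i := fun i hi k => by
    induction k with
    | zero => exact le_rfl
    | succ k ih =>
      exact (hle (i + k) (hmem i hi _ (by omega)) (hmem i hi _ (by omega))).trans ih
  have hdesc : ∀ n, ∀ i ∈ I, f i ≤ n → False := fun n => by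
    induction n with
    | zero =>
      intro i hi hn
      obtain ⟨k, hk, hik⟩ := hJ.exists_gt i
      have h1 := hlt k hk (hmem i hi _ (by omega))
      have h2 := hanti i hi (k - i)
      rw [Nat.add_sub_cancel' hik.le] at h2
      omega
    | succ n ih =>
      intro i hi hn
      obtain ⟨k, hk, hik⟩ := hJ.exists_gt i
      have h1 := hlt k hk (hmem i hi _ (by omega))
      have h2 := hanti i hi (k - i)
      rw [Nat.add_sub_cancel' hik.le] at h2
      exact ih (k + 1) (hmem i hi _ (by omega)) (by omega)
  obtain ⟨i, hi⟩ := hJ.nonempty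
  exact hdesc _ i (hJI hi) le_rfl

/-- An unprovable root fails in the algebra, hence so does a whole infinite branch, and its
progressing thread makes the annotations descend forever. -/
theorem omegaSystem_provable_of_nwfSystem_cut {R : Set SchematicRule}
    (hR : ∀ r ∈ R, r.IsAnalytic) {S : Sequent} (h : (nwfSystem (R ∪ {cut})).Provable S) :
    (omegaSystem R).Provable S := by
  by_contra hS
  obtain ⟨π, hroot, hrules, hbr⟩ := h
  obtain ⟨s₀, hs₀, rfl⟩ := Option.map_eq_some_iff.1 hroot
  -- If the antecedent belonged to the value of the succedent, `val_spec` would prove the sequent.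
  obtain ⟨ds, hds, hfail⟩ := exists_forall₂_good_of_not_mem (R := R)
    (isCl_val _ s₀.concl.suc) s₀.concl.ant [] fun hmem => hS ((val_spec _).2 _ hmem)
  obtain ⟨x, hx0, hx⟩ := exists_failing_branch (fun w s hs => by
    obtain ⟨ρ, hρ, hsρ⟩ := hrules w s hs
    exact stepSound_of_mem_rules hR hρ hsρ) ⟨[], s₀, ds, hs₀, hds, hfail⟩
  have hb : π.IsBranch fun i => (x i).node :=
    ⟨by simp [hx0], fun i => (hx i).imp fun _ h => h.1, fun i => by simp [(x i).label_eq]⟩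
  obtain ⟨-, -, -, I, t, -, ⟨hth, α, hstar⟩, hinf⟩ := hbr _ hb
  have hpos : ∀ i ∈ I, ∃ j d, t i = .left j ∧ (x i).inf.concl.at (.left j) = some (.star α) ∧
      (x i).wit[j]? = some d := fun i hi => by
    obtain ⟨hr, s, hs, hα⟩ := hstar i hi
    obtain rfl : (x i).inf = s := Option.some.inj ((x i).label_eq.symm.trans hs)
    cases ht : t i with
    | right => exact absurd ht hr
    | left j =>
      rw [ht] at hα
      obtain ⟨hj, -⟩ := List.getElem?_eq_some_iff.1 hα
      rw [(x i).good.length_eq] at hj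
      exact ⟨j, _, rfl, hα, List.getElem?_eq_getElem hj⟩
  choose! j d ht hα hd using hpos
  have key : ∀ i ∈ I, i + 1 ∈ I → (d (i + 1)).2 ≤ (d i).2 ∧
      ((x i).inf.principal (t i) → (d (i + 1)).2 < (d i).2) := fun i hi hi' => by
    obtain ⟨s, n, hs, hn, hanc⟩ := hth.2.2.2 i hi hi'
    obtain rfl : (x i).inf = s := Option.some.inj ((x i).label_eq.symm.trans hs)
    obtain ⟨m, hm, hstep⟩ := hx i
    -- The thread and the failing branch use the same premise, since its index is the last entry of
    -- the next node.
    obtain rfl : m = n := by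
      have := hm.symm.trans hn
      simpa using this
    rw [ht i hi, ht (i + 1) hi'] at hanc
    rw [ht i hi]
    exact hstep _ _ α _ _ hanc (hα i hi) (hα _ hi') (hd i hi) (hd _ hi')
  refine false_of_infinite_descent hth.2.1 (fun i hi => hi.1) hinf (fun i => (d i).2)
    (fun i hi hi' => (key i hi hi').1) ?_
  rintro i ⟨hi, s, hs, hp⟩ hi'
  obtain rfl : (x i).inf = s := Option.some.inj ((x i).label_eq.symm.trans hs)
  exact (key i hi hi').2 hp

end ActLat

theorem mainTheorem4 (R : Set ActLat.SchematicRule) (hR : ∀ r ∈ R, r.IsAnalytic) :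
    (∀ S : ActLat.Sequent, (ActLat.omegaSystem (R ∪ {ActLat.cut})).Provable S →
      (ActLat.omegaSystem R).Provable S) ∧
    (∀ S : ActLat.Sequent, (ActLat.nwfSystem (R ∪ {ActLat.cut})).Provable S →
      (ActLat.nwfSystem R).Provable S) :=
  ⟨fun _ h => ActLat.omegaSystem_provable_of_nwfSystem_cut hR
      (ActLat.nwfSystem_provable_of_omegaSystem h),
    fun _ h => ActLat.nwfSystem_provable_of_omegaSystem
      (ActLat.omegaSystem_provable_of_nwfSystem_cut hR h)⟩
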